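/- Let $\mathcal{A}$ be an exact category in the sense of Quillen, i.e. an additive category with a class of kernel--cokernel sequences $A\rightarrowtail B\twoheadrightarrow C$ (the short exact sequences; the first morphism of one is an inflation, the second a deflation) that is closed under isomorphisms and such that identities are inflations and deflations, inflations (resp. deflations) are closed under composition, and pushouts of inflations (resp. pullbacks of deflations) along arbitrary morphisms exist and are inflations (resp. deflations). Let $\operatorname{Ext}^1(A,B)$ be the group of equivalence classes of short exact sequences $B\rightarrowtail E\twoheadrightarrow A$, and for a class $\mathcal{S}$ of objects put $\mathcal{S}^{\perp_1}=\{Y : \operatorname{Ext}^1(S,Y)=0\ \forall S\in\mathcal{S}\}$ and ${}^{\perp_1}\mathcal{S}=\{X : \operatorname{Ext}^1(X,S)=0\ \forall S\in\mathcal{S}\}$. For an ordinal $\lambda>0$, a $\lambda$-sequence of morphisms in a class $\mathcal{D}$ is a functor $X:\lambda\to\mathcal{A}$ with $X_\gamma=\operatorname{colim}_{\alpha<\gamma}X_\alpha$ for all limit ordinals $\gamma<\lambda$ and $X_\alpha\to X_{\alpha+1}$ in $\mathcal{D}$ whenever $\alpha+1<\lambda$; if $\operatorname{colim}_{\alpha<\lambda}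 X_\alpha$ exists, $X_0\to\operatorname{colim}_{\alpha<\lambda} X_\alpha$ is its transfinite composition. Let $I$ be a set of inflations. A relative $I$-cell complex is a transfinite composition of pushouts of morphisms in $I$; $I$-cell is the class of these, and $\mathrm{Cell}(I)$ is the class of objects $A$ with $0\to A$ in $I$-cell. Let $\mathrm{Cok}\,I$ be the class of objects that are cokernels of morphisms in $I$. For a class $\mathcal{S}$ of objects, an object $A$ is $\mathcal{S}$-filtered if $0\to A$ is a transfinite composition of inflations with cokernel in $\mathcal{S}$; the class of these objects is $\mathrm{Filt}\text{-}\mathcal{S}$. Assume that: - $I$ is homological: whenever $A\to 0$ has the right lifting property with respect to all morphisms in $I$, then $A\in(\mathrm{Cok}\,I)^{\perp_1}$; - $I$ admits the small object argument: the transfinite compositions of pushouts of morphisms in $I$ exist; the coproducts of set-indexed families of morphisms in $I$ exist (that is, those of their domains and of their codomains); and for the domain $D$ of each morphism in $I$ there is a cardinal $\kappa$ such that $\operatorname{Hom}(D,-)$ commutes with the colimit of every $\lambda$-sequence of morphisms in $I$-cell with $\mathrm{cf}(\lambda)>\kappa$; - every relative $I$-cell complex is an inflation. A class $\mathcal{T}$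 of objects is a class of generators if every object $A$ admits a deflation $\coprod_{s\in S}G_s\twoheadrightarrow A$ with $S$ a set and all $G_s\in\mathcal{T}$. A cotorsion pair is a pair $(\mathcal{X},\mathcal{Y})$ of classes of objects with $\mathcal{X}={}^{\perp_1}\mathcal{Y}$ and $\mathcal{Y}=\mathcal{X}^{\perp_1}$; it is complete if for every object $A$ there are short exact sequences $Y\rightarrowtail X\twoheadrightarrow A$ and $A\rightarrowtail Y'\twoheadrightarrow X'$ with $X,X'\in\mathcal{X}$ and $Y,Y'\in\mathcal{Y}$. A class of objects is closed under coproducts if it contains every set-indexed coproduct existing in $\mathcal{A}$ of objects of the class. Then: (a) For each object $A$ there is a short exact sequence $A\rightarrowtail T\twoheadrightarrow B$ with $T\in(\mathrm{Cok}\,I)^{\perp_1}$ and $B\in\mathrm{Cell}(I)$. In particular, $(\mathrm{Cok}\,I)^{\perp_1}$ is covariantly finite: each object $A$ has a morphism $A\to Y$ with $Y\in(\mathrm{Cok}\,I)^{\perp_1}$ through which every morphism from $A$ to an object of $(\mathrm{Cok}\,I)^{\perp_1}$ factors. (b) If $\mathrm{Cell}(I)$ is a class of generators, then $({}^{\perp_1}((\mathrm{Cok}\,I)^{\perp_1}),(\mathrm{Cok}\,I)^{\perp_1})$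 is a complete cotorsion pair. (c) If ${}^{\perp_1}((\mathrm{Cok}\,I)^{\perp_1})$ is closed under coproducts and is a class of generators, then for each object $A$ there is a short exact sequence $T'\rightarrowtail B'\twoheadrightarrow A$ with $T'\in(\mathrm{Cok}\,I)^{\perp_1}$ and $B'\in{}^{\perp_1}((\mathrm{Cok}\,I)^{\perp_1})$. In particular, $({}^{\perp_1}((\mathrm{Cok}\,I)^{\perp_1}),(\mathrm{Cok}\,I)^{\perp_1})$ is a complete cotorsion pair. (d) If $\mathrm{Filt}\text{-}\mathrm{Cok}\,I$ is closed under coproducts and extensions and is a class of generators, then ${}^{\perp_1}((\mathrm{Cok}\,I)^{\perp_1})$ consists precisely of the direct summands of $\mathrm{Cok}\,I$-filtered objects. -/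

import Mathlib

open CategoryTheory CategoryTheory.Limits
open scoped ZeroObject

universe v u

section GeneralCategories

variable {C : Type u} [Category.{v} C]

/-- For a nonzero ordinal `λ`, given as a well-ordered type `J`, a functor `F : J ⥤ C` is a
`λ`-sequence of morphisms in `D` if it is continuous at limit ordinals and every morphism
`F_α ⟶ F_{α+1}` with `α + 1 < λ` belongs to `D`. -/
structure IsSequenceOfMorphisms (D : MorphismProperty C) {J : Type v} [LinearOrder J]
    [OrderBot J] [SuccOrder J] [WellFoundedLT J] (F : J ⥤ C) : Prop where
  isWellOrderContinuous : F.IsWellOrderContinuous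
  map_mem (j : J) (hj : ¬ IsMax j) : D (F.map (homOfLE (Order.le_succ j)))

/-- The class `I-cell` of relative `I`-cell complexes: transfinite compositions of pushouts of
morphisms in `I`. -/
def relativeCellComplexes (I : MorphismProperty C) : MorphismProperty C :=
  MorphismProperty.transfiniteCompositions.{v} I.pushouts

/-- `A` is `κ`-small relative to `D`: for every ordinal `λ` of cofinality `> κ`, the functor
`Hom(A, -)` commutes with the colimits of all `λ`-sequences of morphisms in `D`. -/
def IsSmallRelativeWith (κ : Cardinal.{v}) (D : MorphismProperty C) (A : C) : Prop :=
  ∀ (J : Type v) [LinearOrder J] [OrderBot J] [SuccOrder J] [WellFoundedLT J] (F : J ⥤ C),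
    κ < Order.cof J → IsSequenceOfMorphisms D F →
      PreservesColimit F (coyoneda.obj (Opposite.op A))

/-- `A` is small relative to `D`. -/
def IsSmallRelative (D : MorphismProperty C) (A : C) : Prop :=
  ∃ κ : Cardinal.{v}, IsSmallRelativeWith κ D A

/-- `I` admits the small object argument. (Only used for sets `I` of inflations of an exact
category, for which the pushouts of morphisms in `I` always exist.) -/
structure AdmitsSmallObjectArgument (I : MorphismProperty C) : Prop where
  /-- the transfinite compositions of pushouts of morphisms in `I` exist -/
  hasTransfiniteCompositions (J : Type v) [LinearOrder J] [OrderBot J] [SuccOrder J]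
    [WellFoundedLT J] (F : J ⥤ C) : IsSequenceOfMorphisms I.pushouts F → HasColimit F
  /-- the coproducts of (set-indexed families of) morphisms in `I` exist -/
  hasCoproducts (S : Type v) (X Y : S → C) (f : ∀ s, X s ⟶ Y s) :
    (∀ s, I (f s)) → HasCoproduct X ∧ HasCoproduct Y
  /-- the domains of the morphisms in `I` are small relative to `I-cell` -/
  isSmallRelative {X Y : C} (f : X ⟶ Y) : I f → IsSmallRelative (relativeCellComplexes I) X

/-- A class of objects is closed under (set-indexed) coproducts: every coproduct in `C` of objects
of the class belongs to the class. -/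
def IsClosedUnderCoproducts (P : ObjectProperty C) : Prop :=
  ∀ (S : Type v) (G : S → C), (∀ s, P (G s)) →
    ∀ c : Cofan G, Nonempty (IsColimit c) → P c.pt

/-- `f : A ⟶ Y` is a left `P`-approximation of `A`. -/
def IsLeftApproximation (P : ObjectProperty C) {A Y : C} (f : A ⟶ Y) : Prop :=
  P Y ∧ ∀ (Y' : C), P Y' → ∀ g : A ⟶ Y', ∃ h : Y ⟶ Y', f ≫ h = g

/-- `P` is covariantly finite: every object has a left `P`-approximation. -/
def IsCovariantlyFinite (P : ObjectProperty C) : Prop :=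
  ∀ A : C, ∃ (Y : C) (f : A ⟶ Y), IsLeftApproximation P f

end GeneralCategories

section ExactCategories

/-- The morphisms that occur as the first morphism of a sequence in `K`. -/
def firstMorphisms {C : Type u} [Category.{v} C] [HasZeroMorphisms C]
    (K : ShortComplex C → Prop) : MorphismProperty C :=
  fun _ Y f => ∃ (Z : C) (g : Y ⟶ Z) (w : f ≫ g = 0), K (ShortComplex.mk f g w)

/-- The morphisms that occur as the second morphism of a sequence in `K`. -/
def secondMorphisms {C : Type u} [Category.{v} C] [HasZeroMorphisms C]
    (K : ShortComplex C → Prop) : MorphismProperty C :=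
  fun Y _ g => ∃ (X : C) (f : X ⟶ Y) (w : f ≫ g = 0), K (ShortComplex.mk f g w)

/-- A (Quillen) exact structure on an additive category. -/
structure ExactStructure (C : Type u) [Category.{v} C] [Preadditive C] [HasZeroObject C]
    [HasFiniteBiproducts C] where
  /-- the class of short exact sequences (conflations) -/
  conflation : ShortComplex C → Prop
  isKernel (S : ShortComplex C) : conflation S → Nonempty (IsLimit (KernelFork.ofι S.f S.zero))
  isCokernel (S : ShortComplex C) :
    conflation S → Nonempty (IsColimit (CokernelCofork.ofπ S.g S.zero))
  of_iso {S T : ShortComplex C} : Nonempty (S ≅ T) → conflation S → conflation T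
  id_inflation (A : C) : firstMorphisms conflation (𝟙 A)
  id_deflation (A : C) : secondMorphisms conflation (𝟙 A)
  comp_inflation {X Y Z : C} (f : X ⟶ Y) (g : Y ⟶ Z) : firstMorphisms conflation f →
    firstMorphisms conflation g → firstMorphisms conflation (f ≫ g)
  comp_deflation {X Y Z : C} (f : X ⟶ Y) (g : Y ⟶ Z) : secondMorphisms conflation f →
    secondMorphisms conflation g → secondMorphisms conflation (f ≫ g)
  pushout_inflation {X Y X' : C} (f : X ⟶ Y) (a : X ⟶ X') : firstMorphisms conflation f →
    ∃ (Y' : C) (b : Y ⟶ Y') (f' : X' ⟶ Y'), IsPushout f a b f' ∧ firstMorphisms conflation f'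
  pullback_deflation {Y Z Z' : C} (g : Y ⟶ Z) (c : Z' ⟶ Z) : secondMorphisms conflation g →
    ∃ (Y' : C) (b : Y' ⟶ Y) (g' : Y' ⟶ Z'), IsPullback b g' g c ∧ secondMorphisms conflation g'

namespace ExactStructure

variable {C : Type u} [Category.{v} C] [Preadditive C] [HasZeroObject C] [HasFiniteBiproducts C]
  (E : ExactStructure C)

/-- The inflations of the exact category. -/
def inflations : MorphismProperty C := firstMorphisms E.conflation

/-- The deflations of the exact category. -/
def deflations : MorphismProperty C := secondMorphisms E.conflation

/-- The short exact sequences `B ↣ mid ↠ A`. -/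
structure Extension (A B : C) where
  mid : C
  i : B ⟶ mid
  p : mid ⟶ A
  w : i ≫ p = 0
  conflation : E.conflation (ShortComplex.mk i p w)

/-- Two extensions of `A` by `B` are equivalent if there is an isomorphism between their middle
terms that is compatible with the identities of `A` and `B`. -/
instance extensionSetoid (A B : C) : Setoid (E.Extension A B) where
  r x y := ∃ e : x.mid ≅ y.mid, x.i ≫ e.hom = y.i ∧ e.hom ≫ y.p = x.p
  iseqv :=
    { refl := fun x => ⟨Iso.refl _, by simp, by simp⟩
      symm := by
        rintro x y ⟨e, h₁, h₂⟩
        exact ⟨e.symm, by simp [← h₁], by simp [← h₂]⟩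
      trans := by
        rintro x y z ⟨e, h₁, h₂⟩ ⟨e', h₃, h₄⟩
        exact ⟨e ≪≫ e', by simp [← h₃, ← h₁], by simp [← h₂, ← h₄]⟩ }

/-- The Yoneda `Ext¹(A, B)`: equivalence classes of short exact sequences `B ↣ mid ↠ A`. -/
def Ext1 (A B : C) : Type (max u v) := Quotient (E.extensionSetoid A B)

/-- `Ext¹(A, B) = 0`: there is only one class of extensions, that of the split ones, which is the
zero element for the Baer sum. -/
def Ext1Vanishes (A B : C) : Prop := Subsingleton (E.Ext1 A B)

/-- `P^⊥ = {Y | Ext¹(X, Y) = 0 for all X in P}`. -/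
def rightPerp (P : ObjectProperty C) : ObjectProperty C :=
  fun Y => ∀ X, P X → E.Ext1Vanishes X Y

/-- `^⊥P = {X | Ext¹(X, Y) = 0 for all Y in P}`. -/
def leftPerp (P : ObjectProperty C) : ObjectProperty C :=
  fun X => ∀ Y, P Y → E.Ext1Vanishes X Y

/-- `(𝒳, 𝒴)` is a cotorsion pair. -/
structure IsCotorsionPair (X Y : ObjectProperty C) : Prop where
  eq_leftPerp : X = E.leftPerp Y
  eq_rightPerp : Y = E.rightPerp X

/-- `(𝒳, 𝒴)` is a complete cotorsion pair. -/
structure IsCompleteCotorsionPair (X Y : ObjectProperty C) : Prop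
    extends E.IsCotorsionPair X Y where
  enough_projectives (A : C) : ∃ (K M : C) (f : K ⟶ M) (g : M ⟶ A) (w : f ≫ g = 0),
    E.conflation (ShortComplex.mk f g w) ∧ X M ∧ Y K
  enough_injectives (A : C) : ∃ (M Q : C) (f : A ⟶ M) (g : M ⟶ Q) (w : f ≫ g = 0),
    E.conflation (ShortComplex.mk f g w) ∧ X Q ∧ Y M

/-- `P` is a class of generators: every object `A` admits a deflation `∐ G_s ↠ A` from a
(set-indexed) coproduct of objects of `P`. -/
def IsClassOfGenerators (P : ObjectProperty C) : Prop :=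
  ∀ A : C, ∃ (S : Type v) (G : S → C) (c : Cofan G) (p : c.pt ⟶ A),
    (∀ s, P (G s)) ∧ Nonempty (IsColimit c) ∧ E.deflations p

/-- `P` is closed under extensions. -/
def IsClosedUnderExtensions (P : ObjectProperty C) : Prop :=
  ∀ S : ShortComplex C, E.conflation S → P S.X₁ → P S.X₃ → P S.X₂

/-- The inflations having a cokernel in `P`. -/
def inflationsWithCokernelIn (P : ObjectProperty C) : MorphismProperty C :=
  fun _ Y f => E.inflations f ∧ ∃ (Z : C) (g : Y ⟶ Z) (w : f ≫ g = 0),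
    Nonempty (IsColimit (CokernelCofork.ofπ g w)) ∧ P Z

/-- `Filt-P`, the `P`-filtered objects: those `A` for which `0 ⟶ A` is a transfinite composition of
inflations with cokernel in `P`. -/
def filtered (P : ObjectProperty C) : ObjectProperty C :=
  fun A => MorphismProperty.transfiniteCompositions.{v} (E.inflationsWithCokernelIn P)
    (0 : (0 : C) ⟶ A)

end ExactStructure

section Additive

variable {C : Type u} [Category.{v} C] [Preadditive C] [HasZeroObject C] [HasFiniteBiproducts C]

/-- `Cell(I)`, the `I`-cell complexes: those `A` for which `0 ⟶ A` is in `I-cell`. -/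
def cellComplexes (I : MorphismProperty C) : ObjectProperty C :=
  fun A => relativeCellComplexes I (0 : (0 : C) ⟶ A)

/-- `Cok I`, the objects that are a cokernel of some morphism in `I`. -/
def cokernelsOf (I : MorphismProperty C) : ObjectProperty C :=
  fun A => ∃ (X Y : C) (i : X ⟶ Y) (p : Y ⟶ A) (w : i ≫ p = 0),
    I i ∧ Nonempty (IsColimit (CokernelCofork.ofπ p w))

/-- `I` is homological: if `A ⟶ 0` has the right lifting property with respect to `I`, then
`A` belongs to `(Cok I)^⊥`. -/
def ExactStructure.IsHomological (E : ExactStructure C) (I : MorphismProperty C) : Prop :=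
  ∀ A : C, I.rlp (0 : A ⟶ (0 : C)) → E.rightPerp (cokernelsOf I) A

/-- `A` is a direct summand of an object of `P`: some biproduct `A ⊕ A'` belongs to `P`. -/
def IsDirectSummandOf (P : ObjectProperty C) : ObjectProperty C :=
  fun A => ∃ (A' : C) (b : BinaryBicone A A'), Nonempty b.IsBilimit ∧ P b.pt

end Additive

end ExactCategories

universe w v' u'

namespace ExactStructure

attribute [local instance] hasBinaryBiproducts_of_finite_biproducts

variable {C : Type u} [Category.{v} C] [Preadditive C] [HasZeroObject C] [HasFiniteBiproducts C]
  {E : ExactStructure C}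

/-- The pair `(f, g)` is a short exact sequence. -/
def IsConflation (E : ExactStructure C) {X Y Z : C} (f : X ⟶ Y) (g : Y ⟶ Z) : Prop :=
  ∃ w : f ≫ g = 0, E.conflation (ShortComplex.mk f g w)

namespace IsConflation

variable {X Y Z : C} {f : X ⟶ Y} {g : Y ⟶ Z}

lemma zero (h : E.IsConflation f g) : f ≫ g = 0 := h.choose

lemma inflation (h : E.IsConflation f g) : E.inflations f := ⟨_, _, _, h.choose_spec⟩

lemma deflation (h : E.IsConflation f g) : E.deflations g := ⟨_, _, _, h.choose_spec⟩

lemma exists_lift (h : E.IsConflation f g) {W : C} (k : W ⟶ Y) (hk : k ≫ g = 0) :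
    ∃ l : W ⟶ X, l ≫ f = k := by
  obtain ⟨w, h⟩ := h
  obtain ⟨hl⟩ := E.isKernel _ h
  exact ⟨_, (KernelFork.IsLimit.lift' hl k hk).2⟩

lemma exists_desc (h : E.IsConflation f g) {W : C} (k : Y ⟶ W) (hk : f ≫ k = 0) :
    ∃ l : Z ⟶ W, g ≫ l = k := by
  obtain ⟨w, h⟩ := h
  obtain ⟨hl⟩ := E.isCokernel _ h
  exact ⟨_, (CokernelCofork.IsColimit.desc' hl k hk).2⟩

lemma mono (h : E.IsConflation f g) : Mono f := by
  obtain ⟨w, h⟩ := h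
  obtain ⟨hl⟩ := E.isKernel _ h
  exact mono_of_isLimit_fork hl

lemma epi (h : E.IsConflation f g) : Epi g := by
  obtain ⟨w, h⟩ := h
  obtain ⟨hl⟩ := E.isCokernel _ h
  exact epi_of_isColimit_cofork hl

lemma nonempty_isColimit (h : E.IsConflation f g) :
    Nonempty (IsColimit (CokernelCofork.ofπ g h.zero)) :=
  E.isCokernel _ h.choose_spec

lemma of_iso {X' Y' Z' : C} {f' : X' ⟶ Y'} {g' : Y' ⟶ Z'} (h : E.IsConflation f g)
    (e₁ : X ≅ X') (e₂ : Y ≅ Y') (e₃ : Z ≅ Z') (hf : e₁.hom ≫ f' = f ≫ e₂.hom)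
    (hg : e₂.hom ≫ g' = g ≫ e₃.hom) : E.IsConflation f' g' := by
  obtain ⟨w, h⟩ := h
  have w' : f' ≫ g' = 0 := by
    rw [← cancel_epi e₁.hom, ← Category.assoc, hf, Category.assoc, hg, ← Category.assoc, w]
    simp
  exact ⟨w', E.of_iso ⟨ShortComplex.isoMk e₁ e₂ e₃ hf hg⟩ h⟩

end IsConflation

lemma exists_isConflation_of_inflation {X Y : C} {f : X ⟶ Y} (hf : E.inflations f) :
    ∃ (Z : C) (g : Y ⟶ Z), E.IsConflation f g := by
  obtain ⟨Z, g, w, h⟩ := hf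
  exact ⟨Z, g, w, h⟩

lemma exists_isConflation_of_deflation {Y Z : C} {g : Y ⟶ Z} (hg : E.deflations g) :
    ∃ (X : C) (f : X ⟶ Y), E.IsConflation f g := by
  obtain ⟨X, f, w, h⟩ := hg
  exact ⟨X, f, w, h⟩

/-- A kernel of a deflation forms a short exact sequence with it. -/
lemma isConflation_of_deflation {X Y Z : C} {f : X ⟶ Y} {g : Y ⟶ Z} (hg : E.deflations g)
    (w : f ≫ g = 0) [Mono f]
    (hf : ∀ {W : C} (k : W ⟶ Y), k ≫ g = 0 → ∃ l : W ⟶ X, l ≫ f = k) :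
    E.IsConflation f g := by
  obtain ⟨X₀, f₀, h⟩ := exists_isConflation_of_deflation hg
  have := h.mono
  obtain ⟨l, hl⟩ := hf f₀ h.zero
  obtain ⟨l', hl'⟩ := h.exists_lift f w
  refine h.of_iso ⟨l, l', ?_, ?_⟩ (Iso.refl _) (Iso.refl _) (by simpa) (by simp)
  · rw [← cancel_mono f₀]; simp [hl, hl']
  · rw [← cancel_mono f]; simp [hl, hl']

/-- A cokernel of an inflation forms a short exact sequence with it. -/
lemma isConflation_of_inflation {X Y Z : C} {f : X ⟶ Y} {g : Y ⟶ Z} (hf : E.inflations f)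
    (w : f ≫ g = 0) [Epi g]
    (hg : ∀ {W : C} (k : Y ⟶ W), f ≫ k = 0 → ∃ l : Z ⟶ W, g ≫ l = k) :
    E.IsConflation f g := by
  obtain ⟨Z₀, g₀, h⟩ := exists_isConflation_of_inflation hf
  have := h.epi
  obtain ⟨l, hl⟩ := hg g₀ h.zero
  obtain ⟨l', hl'⟩ := h.exists_desc g w
  refine h.of_iso (Iso.refl _) (Iso.refl _) ⟨l', l, ?_, ?_⟩ (by simp) (by simpa using hl'.symm)
  · rw [← cancel_epi g₀]; simp [reassoc_of% hl', hl]
  · rw [← cancel_epi g]; simp [reassoc_of% hl, hl']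

lemma isConflation_of_isColimit {X Y Z : C} {f : X ⟶ Y} {g : Y ⟶ Z} (hf : E.inflations f)
    (w : f ≫ g = 0) (hg : IsColimit (CokernelCofork.ofπ g w)) : E.IsConflation f g := by
  have : Epi g := epi_of_isColimit_cofork hg
  exact isConflation_of_inflation hf w
    (fun k hk ↦ ⟨_, (CokernelCofork.IsColimit.desc' hg k hk).2⟩)

lemma inflations_of_iso {X Y X' Y' : C} {f : X ⟶ Y} {f' : X' ⟶ Y'} (hf : E.inflations f)
    (e₁ : X ≅ X') (e₂ : Y ≅ Y') (h : e₁.hom ≫ f' = f ≫ e₂.hom) : E.inflations f' := by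
  obtain ⟨Z, g, hg⟩ := exists_isConflation_of_inflation hf
  exact (hg.of_iso e₁ e₂ (Iso.refl _) h (g' := e₂.inv ≫ g) (by simp)).inflation

lemma deflations_of_iso {X Y X' Y' : C} {f : X ⟶ Y} {f' : X' ⟶ Y'} (hf : E.deflations f)
    (e₁ : X ≅ X') (e₂ : Y ≅ Y') (h : e₁.hom ≫ f' = f ≫ e₂.hom) : E.deflations f' := by
  obtain ⟨Z, g, hg⟩ := exists_isConflation_of_deflation hf
  exact (hg.of_iso (Iso.refl _) e₁ e₂ (f' := g ≫ e₁.hom) (by simp) h).deflation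

variable (E) in
lemma isConflation_id_zero (X : C) : E.IsConflation (𝟙 X) (0 : X ⟶ (0 : C)) :=
  isConflation_of_inflation (E.id_inflation X) (by simp)
    (fun k hk ↦ ⟨0, by simpa using hk.symm⟩)

variable (E) in
lemma isConflation_zero_id (X : C) : E.IsConflation (0 : (0 : C) ⟶ X) (𝟙 X) :=
  isConflation_of_deflation (E.id_deflation X) (by simp)
    (fun k hk ↦ ⟨0, by simpa using hk.symm⟩)

/-- The cokernel of an inflation is also the cokernel of its pushouts. -/
lemma IsConflation.of_isPushout {X Y Z X' Y' : C} {f : X ⟶ Y} {g : Y ⟶ Z} {a : X ⟶ X'}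
    {b : Y ⟶ Y'} {f' : X' ⟶ Y'} (h : E.IsConflation f g) (sq : IsPushout f a b f') :
    ∃ g' : Y' ⟶ Z, b ≫ g' = g ∧ E.IsConflation f' g' := by
  obtain ⟨Y₀, b₀, f₀, sq₀, hf₀⟩ := E.pushout_inflation f a h.inflation
  have hf' : E.inflations f' := inflations_of_iso (E := E) hf₀ (Iso.refl _)
    (sq₀.isoIsPushout _ _ sq) (by simp)
  obtain ⟨g', hg₁, hg₂⟩ : ∃ g', b ≫ g' = g ∧ f' ≫ g' = 0 :=
    ⟨sq.desc g 0 (by simp [h.zero]), by simp, by simp⟩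
  have := h.epi
  have : Epi g' := epi_of_epi_fac hg₁
  refine ⟨g', hg₁, isConflation_of_inflation hf' hg₂ (fun k hk ↦ ?_)⟩
  obtain ⟨l, hl⟩ := h.exists_desc (b ≫ k) (by rw [sq.w_assoc, hk, comp_zero])
  exact ⟨l, sq.hom_ext (by rw [← hl, reassoc_of% hg₁]) (by rw [reassoc_of% hg₂, hk, zero_comp])⟩

/-- The kernel of a deflation is also the kernel of its pullbacks. -/
lemma IsConflation.of_isPullback {X Y Z Y' Z' : C} {f : X ⟶ Y} {g : Y ⟶ Z} {c : Z' ⟶ Z}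
    {b : Y' ⟶ Y} {g' : Y' ⟶ Z'} (h : E.IsConflation f g) (sq : IsPullback b g' g c) :
    ∃ f' : X ⟶ Y', f' ≫ b = f ∧ E.IsConflation f' g' := by
  obtain ⟨Y₀, b₀, g₀, sq₀, hg₀⟩ := E.pullback_deflation g c h.deflation
  have hg' : E.deflations g' := deflations_of_iso (E := E) hg₀
    (sq₀.isoIsPullback _ _ sq) (Iso.refl _) (by simp)
  obtain ⟨f', hf₁, hf₂⟩ : ∃ f', f' ≫ b = f ∧ f' ≫ g' = 0 :=
    ⟨sq.lift f 0 (by simp [h.zero]), by simp, by simp⟩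
  have := h.mono
  have : Mono f' := mono_of_mono_fac hf₁
  refine ⟨f', hf₁, isConflation_of_deflation hg' hf₂ (fun k hk ↦ ?_)⟩
  obtain ⟨l, hl⟩ := h.exists_lift (k ≫ b) (by rw [Category.assoc, sq.w, reassoc_of% hk, zero_comp])
  exact ⟨l, sq.hom_ext (by rw [← hl, Category.assoc, hf₁])
    (by rw [Category.assoc, hf₂, hk, comp_zero])⟩

lemma exists_isPushout {X Y X' : C} {f : X ⟶ Y} (hf : E.inflations f) (a : X ⟶ X') :
    ∃ (Y' : C) (b : Y ⟶ Y') (f' : X' ⟶ Y'), IsPushout f a b f' := by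
  obtain ⟨Y', b, f', h, _⟩ := E.pushout_inflation f a hf
  exact ⟨Y', b, f', h⟩

lemma exists_isPullback {Y Z Z' : C} {g : Y ⟶ Z} (hg : E.deflations g) (c : Z' ⟶ Z) :
    ∃ (Y' : C) (b : Y' ⟶ Y) (g' : Y' ⟶ Z'), IsPullback b g' g c := by
  obtain ⟨Y', b, f', h, _⟩ := E.pullback_deflation g c hg
  exact ⟨Y', b, f', h⟩

variable (E) in
lemma isConflation_inl_snd (X Y : C) :
    E.IsConflation (biprod.inl : X ⟶ X ⊞ Y) (biprod.snd : X ⊞ Y ⟶ Y) := by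
  obtain ⟨g, hg, h⟩ := (isConflation_zero_id E Y).of_isPushout
    (IsPushout.of_has_biproduct X Y).flip
  obtain rfl : g = biprod.snd := biprod.hom_ext' _ _ (by simp [h.zero]) (by simp [hg])
  exact h

/-- A short exact sequence with a section is isomorphic to a biproduct sequence. -/
lemma IsConflation.exists_iso_of_section {X Y Z : C} {f : X ⟶ Y} {g : Y ⟶ Z}
    (h : E.IsConflation f g) (s : Z ⟶ Y) (hs : s ≫ g = 𝟙 Z) :
    ∃ e : X ⊞ Z ≅ Y, biprod.inl ≫ e.hom = f ∧ biprod.inr ≫ e.hom = s ∧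
      e.hom ≫ g = biprod.snd := by
  have := h.mono
  obtain ⟨r, hr⟩ := h.exists_lift (𝟙 Y - g ≫ s) (by simp [Preadditive.sub_comp, hs])
  have hfr : f ≫ r = 𝟙 X := by
    rw [← cancel_mono f, Category.assoc, hr]
    simp [Preadditive.comp_sub, reassoc_of% h.zero]
  have hsr : s ≫ r = 0 := by
    rw [← cancel_mono f, Category.assoc, hr]
    simp [Preadditive.comp_sub, reassoc_of% hs]
  refine ⟨⟨biprod.desc f s, biprod.lift r g, ?_, ?_⟩, by simp, by simp, ?_⟩
  · apply biprod.hom_ext' <;> apply biprod.hom_ext <;> simp [hfr, hsr, h.zero, hs]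
  · simp [biprod.lift_desc, hr]
  · apply biprod.hom_ext' <;> simp [h.zero, hs]

lemma ext1Vanishes_iff_exists_section {A B : C} :
    E.Ext1Vanishes A B ↔ ∀ {M : C} (i : B ⟶ M) (p : M ⟶ A), E.IsConflation i p →
      ∃ s : A ⟶ M, s ≫ p = 𝟙 A := by
  constructor
  · intro h M i p hip
    obtain ⟨e, _, he⟩ := Quotient.exact (s := E.extensionSetoid A B)
      (@Subsingleton.elim _ h
        (Quotient.mk _ ⟨B ⊞ A, biprod.inl, biprod.snd, _,
          (isConflation_inl_snd E B A).choose_spec⟩)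
        (Quotient.mk _ ⟨M, i, p, _, hip.choose_spec⟩))
    exact ⟨biprod.inr ≫ e.hom, by simp [he]⟩
  · intro h
    refine ⟨fun x y ↦ ?_⟩
    induction x using Quotient.inductionOn with | _ x
    induction y using Quotient.inductionOn with | _ y
    obtain ⟨s, hs⟩ := h x.i x.p ⟨x.w, x.conflation⟩
    obtain ⟨t, ht⟩ := h y.i y.p ⟨y.w, y.conflation⟩
    obtain ⟨e, he₁, _, he₃⟩ :=
      IsConflation.exists_iso_of_section (E := E) ⟨x.w, x.conflation⟩ s hs
    obtain ⟨e', he₁', _, he₃'⟩ :=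
      IsConflation.exists_iso_of_section (E := E) ⟨y.w, y.conflation⟩ t ht
    exact Quotient.sound ⟨e.symm ≪≫ e', by simp [← he₁, he₁'], by simp [← he₃, he₃']⟩

lemma Ext1Vanishes.exists_section {A B M : C} (h : E.Ext1Vanishes A B) {i : B ⟶ M} {p : M ⟶ A}
    (hip : E.IsConflation i p) : ∃ s : A ⟶ M, s ≫ p = 𝟙 A :=
  ext1Vanishes_iff_exists_section.1 h i p hip

lemma Ext1Vanishes.exists_retraction {A B M : C} (h : E.Ext1Vanishes A B) {i : B ⟶ M} {p : M ⟶ A}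
    (hip : E.IsConflation i p) : ∃ r : M ⟶ B, i ≫ r = 𝟙 B := by
  obtain ⟨s, hs⟩ := h.exists_section hip
  obtain ⟨e, he, _⟩ := hip.exists_iso_of_section s hs
  exact ⟨e.inv ≫ biprod.fst, by simp [← he]⟩

/-- If `Ext¹(S, Y) = 0`, a section of a deflation with kernel `Y` over a subobject with
quotient `S` extends to a section. -/
lemma Ext1Vanishes.exists_section_extension {X X' S Y M : C} (hSY : E.Ext1Vanishes S Y)
    {f : X ⟶ X'} {g : X' ⟶ S} (hf : E.IsConflation f g) {i : Y ⟶ M} {p : M ⟶ X'}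
    (hp : E.IsConflation i p) (u : X ⟶ M) (hu : u ≫ p = f) :
    ∃ s : X' ⟶ M, s ≫ p = 𝟙 X' ∧ f ≫ s = u := by
  have := hf.mono
  have := hp.mono
  have := hp.epi
  obtain ⟨N, k, hk⟩ := exists_isConflation_of_deflation (E := E)
    (E.comp_deflation p g hp.deflation hf.deflation)
  have := hk.mono
  obtain ⟨i', hi'⟩ := hk.exists_lift i (by simp [reassoc_of% hp.zero])
  obtain ⟨u', hu'⟩ := hk.exists_lift u (by simp [reassoc_of% hu, hf.zero])
  obtain ⟨q, hq⟩ := hf.exists_lift (k ≫ p) (by simp [hk.zero])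
  have hiq : i' ≫ q = 0 := by
    rw [← cancel_mono f, Category.assoc, hq, reassoc_of% hi', hp.zero, zero_comp]
  have huq : u' ≫ q = 𝟙 X := by
    rw [← cancel_mono f, Category.assoc, hq, reassoc_of% hu', hu, Category.id_comp]
  obtain ⟨t, ht⟩ := hp.exists_lift (k - q ≫ u) (by
    rw [Preadditive.sub_comp, Category.assoc, hu, hq, sub_self])
  have hit : i' ≫ t = 𝟙 Y := by
    rw [← cancel_mono i, Category.assoc, ht]
    simp [Preadditive.comp_sub, hi', reassoc_of% hiq]
  have hut : u' ≫ t = 0 := by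
    rw [← cancel_mono i, Category.assoc, ht]
    simp [Preadditive.comp_sub, hu', reassoc_of% huq]
  obtain ⟨P, b, j, sq⟩ := exists_isPushout hk.inflation t
  obtain ⟨g', -, hg'⟩ := hk.of_isPushout sq
  obtain ⟨r, hr⟩ := hSY.exists_retraction hg'
  have hkr : k ≫ b ≫ r = t := by rw [sq.w_assoc, hr, Category.comp_id]
  have hir : i ≫ b ≫ r = 𝟙 Y := by rw [← hi', Category.assoc, hkr, hit]
  have hur : u ≫ b ≫ r = 0 := by rw [← hu', Category.assoc, hkr, hut]
  obtain ⟨s, hs⟩ := hp.exists_desc (𝟙 M - (b ≫ r) ≫ i) (by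
    simp [Preadditive.comp_sub, reassoc_of% hir])
  refine ⟨s, ?_, ?_⟩
  · rw [← cancel_epi p, reassoc_of% hs]
    simp [Preadditive.sub_comp, hp.zero]
  · rw [← hu, Category.assoc, hs]
    simp [Preadditive.comp_sub, reassoc_of% hur]

/-- The deflations whose kernel belongs to `P`. -/
def deflationsWithKernelIn (E : ExactStructure C) (P : ObjectProperty C) : MorphismProperty C :=
  fun M _ p ↦ ∃ (Y : C) (i : Y ⟶ M), E.IsConflation i p ∧ P Y

lemma hasLiftingProperty_of_ext1Vanishes {X X' S Y M Z : C} (hSY : E.Ext1Vanishes S Y)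
    {f : X ⟶ X'} {g : X' ⟶ S} (hf : E.IsConflation f g) {i : Y ⟶ M} {p : M ⟶ Z}
    (hp : E.IsConflation i p) : HasLiftingProperty f p where
  sq_hasLift {a b} sq := by
    obtain ⟨M', c, p', sq'⟩ := exists_isPullback hp.deflation b
    obtain ⟨i', -, hp'⟩ := hp.of_isPullback sq'
    obtain ⟨s, hs₁, hs₂⟩ := hSY.exists_section_extension hf hp' (sq'.lift a f sq.w) (by simp)
    exact ⟨⟨s ≫ c, by rw [reassoc_of% hs₂]; simp, by rw [Category.assoc, sq'.w, reassoc_of% hs₁]⟩⟩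

/-- `X` belongs to `^⊥P` if and only if `0 ⟶ X` has the left lifting property with respect to the
deflations with kernel in `P`. -/
lemma leftPerp_iff_llp {P : ObjectProperty C} {X : C} :
    E.leftPerp P X ↔ (E.deflationsWithKernelIn P).llp (0 : (0 : C) ⟶ X) := by
  constructor
  · rintro h M Z p ⟨Y, i, hp, hY⟩
    exact hasLiftingProperty_of_ext1Vanishes (h Y hY) (isConflation_zero_id E X) hp
  · intro h Y hY
    rw [ext1Vanishes_iff_exists_section]
    intro M i p hp
    have := h p ⟨Y, i, hp, hY⟩
    have sq : CommSq (0 : (0 : C) ⟶ M) (0 : (0 : C) ⟶ X) p (𝟙 X) := ⟨by simp⟩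
    exact ⟨sq.lift, sq.fac_right⟩

lemma llp_of_leftPerp {P : ObjectProperty C} {X Y Z : C} {f : X ⟶ Y} {g : Y ⟶ Z}
    (h : E.IsConflation f g) (hZ : E.leftPerp P Z) : (E.deflationsWithKernelIn P).llp f := by
  rintro M W p ⟨K, i, hp, hK⟩
  exact hasLiftingProperty_of_ext1Vanishes (hZ K hK) h hp

lemma leftPerp_of_isConflation {P : ObjectProperty C} {X Y Z : C} {f : X ⟶ Y} {g : Y ⟶ Z}
    (h : E.IsConflation f g) (hX : E.leftPerp P X) (hZ : E.leftPerp P Z) : E.leftPerp P Y := by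
  rw [leftPerp_iff_llp] at hX ⊢
  simpa using MorphismProperty.comp_mem _ _ _ hX (llp_of_leftPerp h hZ)

lemma leftPerp_of_retract {P : ObjectProperty C} {X Y : C} (i : X ⟶ Y) (r : Y ⟶ X)
    (h : i ≫ r = 𝟙 X) (hY : E.leftPerp P Y) : E.leftPerp P X := by
  rw [leftPerp_iff_llp] at hY ⊢
  refine MorphismProperty.of_retract (P := (E.deflationsWithKernelIn P).llp)
    (⟨Arrow.homMk 0 i (by simp), Arrow.homMk 0 r (by simp), ?_⟩ :
      RetractArrow (0 : (0 : C) ⟶ X) (0 : (0 : C) ⟶ Y)) hY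
  ext <;> simp [h]

lemma isClosedUnderCoproducts_leftPerp (P : ObjectProperty C) :
    IsClosedUnderCoproducts (E.leftPerp P) := by
  intro S G hG c ⟨hc⟩ Y hY
  rw [ext1Vanishes_iff_exists_section]
  intro M i p hp
  have (s : S) : ∃ t : G s ⟶ M, t ≫ p = c.inj s := by
    have := leftPerp_iff_llp.1 (hG s) p ⟨Y, i, hp, hY⟩
    have sq : CommSq (0 : (0 : C) ⟶ M) (0 : (0 : C) ⟶ G s) p (c.inj s) := ⟨by simp⟩
    exact ⟨sq.lift, sq.fac_right⟩
  choose t ht using this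
  refine ⟨Cofan.IsColimit.desc hc t, Cofan.IsColimit.hom_ext hc _ _ (fun s ↦ ?_)⟩
  rw [← Category.assoc, Cofan.IsColimit.fac, ht, Category.comp_id]

lemma le_leftPerp_rightPerp (P : ObjectProperty C) : P ≤ E.leftPerp (E.rightPerp P) :=
  fun X hX _ hY ↦ hY X hX

lemma rightPerp_leftPerp_rightPerp (P : ObjectProperty C) :
    E.rightPerp (E.leftPerp (E.rightPerp P)) = E.rightPerp P :=
  le_antisymm (fun _ hY X hX ↦ hY X (le_leftPerp_rightPerp P X hX)) (fun Y hY _ hX ↦ hX Y hY)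

lemma isCotorsionPair_leftPerp_rightPerp (P : ObjectProperty C) :
    E.IsCotorsionPair (E.leftPerp (E.rightPerp P)) (E.rightPerp P) :=
  ⟨rfl, (rightPerp_leftPerp_rightPerp P).symm⟩

lemma inflationsWithCokernelIn_le_llp (P : ObjectProperty C) :
    E.inflationsWithCokernelIn P ≤ (E.deflationsWithKernelIn (E.rightPerp P)).llp := by
  rintro X Y f ⟨hf, Z, g, w, ⟨hg⟩, hZ⟩
  exact llp_of_leftPerp (isConflation_of_isColimit hf w hg) (le_leftPerp_rightPerp P Z hZ)

/-- Filtered objects inherit vanishing of `Ext¹` from their subquotients (the Eklof lemma). -/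
lemma filtered_le_leftPerp_rightPerp (P : ObjectProperty C) :
    E.filtered P ≤ E.leftPerp (E.rightPerp P) := by
  intro X hX
  rw [leftPerp_iff_llp]
  exact MorphismProperty.transfiniteCompositions_le_iff.2 (inflationsWithCokernelIn_le_llp P) _ hX

lemma pushouts_le_inflationsWithCokernelIn {I : MorphismProperty C} (hI : I ≤ E.inflations) :
    I.pushouts ≤ E.inflationsWithCokernelIn (cokernelsOf I) := by
  rintro X' Y' f' ⟨X, Y, f, a, b, hf, sq⟩
  obtain ⟨Z, g, h⟩ := exists_isConflation_of_inflation (hI _ hf)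
  obtain ⟨g', -, h'⟩ := h.of_isPushout sq.flip
  exact ⟨h'.inflation, Z, g', h'.zero, h'.nonempty_isColimit,
    X, Y, f, g, h.zero, hf, h.nonempty_isColimit⟩

lemma cellComplexes_le_filtered {I : MorphismProperty C} (hI : I ≤ E.inflations) :
    cellComplexes I ≤ E.filtered (cokernelsOf I) :=
  fun _ hX ↦ MorphismProperty.transfiniteCompositions_monotone
    (pushouts_le_inflationsWithCokernelIn hI) _ hX

/-- Given a deflation `G ↠ A` and short exact sequences `K ↣ T ↠ B` for all `K`,
one obtains `T ↣ M ↠ A` with `M` an extension of `B` by `G`. -/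
lemma exists_isConflation_of_deflation_of_approximation {G A : C} {p : G ⟶ A}
    (hp : E.deflations p) {P Q : ObjectProperty C}
    (h : ∀ K : C, ∃ (T B : C) (f : K ⟶ T) (g : T ⟶ B), E.IsConflation f g ∧ P T ∧ Q B) :
    ∃ (T M B : C) (f : T ⟶ M) (g : M ⟶ A) (i : G ⟶ M) (q : M ⟶ B),
      E.IsConflation f g ∧ E.IsConflation i q ∧ P T ∧ Q B := by
  obtain ⟨K, k, hk⟩ := exists_isConflation_of_deflation hp
  obtain ⟨T, B, f, g, hfg, hT, hB⟩ := h K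
  obtain ⟨M, b, f', sq⟩ := exists_isPushout hk.inflation f
  obtain ⟨p', -, hp'⟩ := hk.of_isPushout sq
  obtain ⟨g', -, hg'⟩ := hfg.of_isPushout sq.flip
  exact ⟨T, M, B, f', p', b, g', hp', hg', hT, hB⟩

end ExactStructure

section WellOrderContinuity

variable {C : Type*} [Category* C] {J : Type*} [PartialOrder J]

lemma CategoryTheory.Functor.exists_desc_of_isSuccLimit (F : J ⥤ C) [F.IsWellOrderContinuous]
    {m : J} (hm : Order.IsSuccLimit m) {Z : C} (f : ∀ a, a < m → (F.obj a ⟶ Z))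
    (hf : ∀ a b (hab : a ≤ b) (hb : b < m), F.map (homOfLE hab) ≫ f b hb = f a (hab.trans_lt hb)) :
    ∃ g : F.obj m ⟶ Z, ∀ a (ha : a < m), F.map (homOfLE ha.le) ≫ g = f a ha := by
  let s : Cocone ((Set.principalSegIio m).monotone.functor ⋙ F) :=
    { pt := Z
      ι := { app := fun a ↦ f a.1 a.2
             naturality := fun a b φ ↦ by
               simpa using! hf a.1 b.1 (leOfHom φ) b.2 } }
  exact ⟨(F.isColimitOfIsWellOrderContinuous m hm).desc s,
    fun a ha ↦ (F.isColimitOfIsWellOrderContinuous m hm).fac s ⟨a, ha⟩⟩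

lemma CategoryTheory.Functor.hom_ext_of_isSuccLimit (F : J ⥤ C) [F.IsWellOrderContinuous]
    {m : J} (hm : Order.IsSuccLimit m) {Z : C} {f g : F.obj m ⟶ Z}
    (h : ∀ a (ha : a < m), F.map (homOfLE ha.le) ≫ f = F.map (homOfLE ha.le) ≫ g) : f = g :=
  (F.isColimitOfIsWellOrderContinuous m hm).hom_ext (fun a ↦ h a.1 a.2)

lemma CategoryTheory.Functor.isWellOrderContinuous_of_exists_desc (F : J ⥤ C)
    (hdesc : ∀ m : J, Order.IsSuccLimit m → ∀ (Z : C) (f : ∀ a, a < m → (F.obj a ⟶ Z)),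
      (∀ a b (hab : a ≤ b) (hb : b < m),
        F.map (homOfLE hab) ≫ f b hb = f a (hab.trans_lt hb)) →
      ∃ g : F.obj m ⟶ Z, ∀ a (ha : a < m), F.map (homOfLE ha.le) ≫ g = f a ha)
    (hext : ∀ m : J, Order.IsSuccLimit m → ∀ (Z : C) (f g : F.obj m ⟶ Z),
      (∀ a (ha : a < m), F.map (homOfLE ha.le) ≫ f = F.map (homOfLE ha.le) ≫ g) → f = g) :
    F.IsWellOrderContinuous where
  nonempty_isColimit m hm := by
    have (s : Cocone ((Set.principalSegIio m).monotone.functor ⋙ F)) :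
        ∃ g : F.obj m ⟶ s.pt, ∀ a (ha : a < m), F.map (homOfLE ha.le) ≫ g = s.ι.app ⟨a, ha⟩ :=
      hdesc m hm s.pt (fun a ha ↦ s.ι.app ⟨a, ha⟩) (fun a b hab hb ↦
        s.w (homOfLE hab : (⟨a, hab.trans_lt hb⟩ : Set.Iio m) ⟶ ⟨b, hb⟩))
    choose g hg using this
    exact ⟨{ desc := g
             fac := fun s a ↦ hg s a.1 a.2
             uniq := fun s f hf ↦ hext m hm _ _ _ (fun a ha ↦
               (hf ⟨a, ha⟩).trans (hg s a ha).symm) }⟩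

end WellOrderContinuity

section QuotientsByInitialTerm

variable {C : Type u} [Category.{v} C] [Preadditive C]
  {J : Type*} [LinearOrder J] [OrderBot J] {F Q : J ⥤ C}

/-- The natural transformation `π : F ⟶ Q` exhibits each `Q.obj j` as the cokernel of
`F.obj ⊥ ⟶ F.obj j`. -/
structure IsQuotientByBot (π : F ⟶ Q) : Prop where
  epi (j : J) : Epi (π.app j)
  zero (j : J) : F.map (homOfLE (bot_le : ⊥ ≤ j)) ≫ π.app j = 0
  exists_desc {j : J} {Z : C} (k : F.obj j ⟶ Z) :
    F.map (homOfLE (bot_le : ⊥ ≤ j)) ≫ k = 0 → ∃ l : Q.obj j ⟶ Z, π.app j ≫ l = k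

lemma exists_isQuotientByBot (F : J ⥤ C)
    (h : ∀ j, HasCokernel (F.map (homOfLE (bot_le : ⊥ ≤ j)))) :
    ∃ (Q : J ⥤ C) (π : F ⟶ Q), IsQuotientByBot π := by
  have hw {j k : J} (φ : j ⟶ k) : F.map (homOfLE (bot_le : ⊥ ≤ j)) ≫ F.map φ ≫
      cokernel.π (F.map (homOfLE (bot_le : ⊥ ≤ k))) = 0 := by
    rw [← Category.assoc, ← F.map_comp]
    exact cokernel.condition _
  let Q : J ⥤ C :=
    { obj := fun j ↦ cokernel (F.map (homOfLE (bot_le : ⊥ ≤ j)))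
      map := fun {j k} φ ↦ cokernel.desc _ (F.map φ ≫ cokernel.π _) (hw φ) }
  let π : F ⟶ Q :=
    { app := fun j ↦ cokernel.π (F.map (homOfLE (bot_le : ⊥ ≤ j)))
      naturality := fun j k φ ↦ (cokernel.π_desc _ _ (hw φ)).symm }
  exact ⟨Q, π, fun j ↦ inferInstanceAs (Epi (cokernel.π _)), fun j ↦ cokernel.condition _,
    fun k hk ↦ ⟨cokernel.desc _ k hk, cokernel.π_desc _ _ _⟩⟩

namespace IsQuotientByBot

variable {π : F ⟶ Q} (hπ : IsQuotientByBot π)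

include hπ

lemma app_bot : π.app ⊥ = 0 := by
  have := hπ.zero ⊥
  rwa [Subsingleton.elim (homOfLE (bot_le : (⊥ : J) ≤ ⊥)) (𝟙 _), F.map_id,
    Category.id_comp] at this

lemma isZero_obj_bot : IsZero (Q.obj ⊥) := by
  have := hπ.epi ⊥
  rw [IsZero.iff_id_eq_zero, ← cancel_epi (π.app ⊥), hπ.app_bot, zero_comp, zero_comp]

lemma isPushout {j k : J} (φ : j ⟶ k) :
    IsPushout (F.map φ) (π.app j) (π.app k) (Q.map φ) := by
  have hj := hπ.epi j
  have hk := hπ.epi k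
  have hdesc (s : PushoutCocone (F.map φ) (π.app j)) :
      ∃ l : Q.obj k ⟶ s.pt, π.app k ≫ l = s.inl := hπ.exists_desc _ (by
    have : homOfLE (bot_le : ⊥ ≤ k) = homOfLE bot_le ≫ φ := rfl
    rw [this, F.map_comp, Category.assoc, s.condition, ← Category.assoc, hπ.zero, zero_comp])
  choose l hl using hdesc
  refine ⟨⟨π.naturality φ⟩, ⟨PushoutCocone.IsColimit.mk _ l hl (fun s ↦ ?_)
    (fun s m h₁ h₂ ↦ ?_)⟩⟩
  · rw [← cancel_epi (π.app j), ← NatTrans.naturality_assoc, ← s.condition, hl]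
  · rw [← cancel_epi (π.app k), h₁, hl]

lemma isWellOrderContinuous [F.IsWellOrderContinuous] : Q.IsWellOrderContinuous := by
  have := hπ.epi
  refine Q.isWellOrderContinuous_of_exists_desc (fun m hm Z f hf ↦ ?_) (fun m hm Z f g h ↦ ?_)
  · obtain ⟨g, hg⟩ := F.exists_desc_of_isSuccLimit hm (fun a ha ↦ π.app a ≫ f a ha)
      (fun a b hab hb ↦ by rw [NatTrans.naturality_assoc, hf])
    obtain ⟨g', rfl⟩ := hπ.exists_desc g (by rw [hg ⊥ hm.bot_lt, hπ.app_bot, zero_comp])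
    exact ⟨g', fun a ha ↦ by
      rw [← cancel_epi (π.app a), ← NatTrans.naturality_assoc, hg a ha]⟩
  · rw [← cancel_epi (π.app m)]
    refine F.hom_ext_of_isSuccLimit hm (fun a ha ↦ ?_)
    rw [NatTrans.naturality_assoc, h a ha, NatTrans.naturality_assoc]

/-- The colimit of the quotients of `F` by `F.obj ⊥` is the cokernel of `F.obj ⊥ ⟶ colim F`. -/
lemma exists_isColimit {T B : C} {ι : F ⟶ (Functor.const J).obj T}
    (hι : IsColimit (Cocone.mk T ι)) {g : T ⟶ B} (w : ι.app ⊥ ≫ g = 0)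
    (hg : IsColimit (CokernelCofork.ofπ g w)) :
    ∃ ι' : Q ⟶ (Functor.const J).obj B, Nonempty (IsColimit (Cocone.mk B ι')) := by
  have := hπ.epi
  have : Epi g := epi_of_isColimit_cofork hg
  have hnat {j k : J} (φ : j ⟶ k) : F.map φ ≫ ι.app k = ι.app j := by simp
  have hex (j : J) : ∃ i : Q.obj j ⟶ B, π.app j ≫ i = ι.app j ≫ g :=
    hπ.exists_desc _ (by rw [← Category.assoc, hnat, w])
  choose i hi using hex
  let ι' : Q ⟶ (Functor.const J).obj B :=
    { app := i
      naturality := fun j k φ ↦ by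
        rw [← cancel_epi (π.app j), ← NatTrans.naturality_assoc]
        simp only [Functor.const_obj_obj, Functor.const_obj_map, Category.comp_id]
        rw [hi, hi, ← Category.assoc, hnat] }
  have hdesc (s : Cocone Q) : ∃ l : B ⟶ s.pt, ∀ j, i j ≫ l = s.ι.app j := by
    let t : Cocone F := (Cocone.precompose π).obj s
    have ht (j : J) : ι.app j ≫ hι.desc t = π.app j ≫ s.ι.app j := hι.fac t j
    obtain ⟨l, hl⟩ : ∃ l : B ⟶ s.pt, g ≫ l = hι.desc t :=
      ⟨_, (CokernelCofork.IsColimit.desc' hg (hι.desc t)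
        (by rw [ht, hπ.app_bot, zero_comp])).2⟩
    refine ⟨l, fun j ↦ ?_⟩
    rw [← cancel_epi (π.app j), ← Category.assoc, hi, Category.assoc, hl, ht]
  choose l hl using hdesc
  refine ⟨ι', ⟨{ desc := l, fac := hl, uniq := fun s m hm ↦ ?_ }⟩⟩
  change B ⟶ s.pt at m
  replace hm (j : J) : i j ≫ m = s.ι.app j := hm j
  have (j : J) : ι.app j ≫ g ≫ m = ι.app j ≫ g ≫ l s := by
    rw [← Category.assoc, ← hi, Category.assoc, hm, ← hl, ← Category.assoc, hi, Category.assoc]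
  exact (cancel_epi g).1 (hι.hom_ext this)

end IsQuotientByBot

end QuotientsByInitialTerm

lemma CategoryTheory.IsPushout.pushouts_mem {C : Type u} [Category.{v} C] {I : MorphismProperty C}
    {X Y X' Y' : C} {f : X ⟶ Y} {f' : X' ⟶ Y'} {a : X ⟶ X'} {b : Y ⟶ Y'}
    (sq : IsPushout f a b f') (hf : I.pushouts f) : I.pushouts f' := by
  obtain ⟨W, Z, g, c, d, hg, sq'⟩ := hf
  exact ⟨W, Z, g, c ≫ a, d ≫ b, hg, sq'.paste_horiz sq.flip⟩

namespace ExactStructure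

variable {C : Type u} [Category.{v} C] [Preadditive C] [HasZeroObject C] [HasFiniteBiproducts C]
  {E : ExactStructure C}

/-- The cokernel of a relative cell complex is a cell complex. -/
lemma cellComplexes_of_isConflation {I : MorphismProperty C}
    (hI : relativeCellComplexes I ≤ E.inflations) {A T B : C} {f : A ⟶ T} {g : T ⟶ B}
    (h : E.IsConflation f g) (hf : relativeCellComplexes I f) : cellComplexes I B := by
  obtain ⟨J, _, _, _, _, ⟨hf⟩⟩ := (MorphismProperty.transfiniteCompositions_iff _ _).1 hf
  obtain ⟨Q, π, hπ⟩ := exists_isQuotientByBot hf.F (fun j ↦ by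
    obtain ⟨Z, p, hp⟩ := exists_isConflation_of_inflation (hI _
      (MorphismProperty.transfiniteCompositionsOfShape_le_transfiniteCompositions _ _ _
        (hf.iic j).mem))
    exact ⟨⟨_, hp.nonempty_isColimit.some⟩⟩)
  have h' : E.IsConflation (hf.incl.app ⊥) g :=
    h.of_iso hf.isoBot.symm (Iso.refl _) (Iso.refl _) (by simp) (by simp)
  obtain ⟨i, ⟨hi⟩⟩ := hπ.exists_isColimit hf.isColimit h'.zero h'.nonempty_isColimit.some
  refine MorphismProperty.transfiniteCompositionsOfShape_le_transfiniteCompositions _ J _ ⟨?_⟩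
  exact
    { F := Q
      isWellOrderContinuous := hπ.isWellOrderContinuous
      isoBot := hπ.isZero_obj_bot.iso (isZero_zero C)
      incl := i
      isColimit := hi
      fac := (isZero_zero C).eq_of_src _ _
      map_mem := fun j hj ↦ (hπ.isPushout _).pushouts_mem (hf.map_mem j hj) }

end ExactStructure

section LexicographicSums

variable {J : Type*} {Q : J → Type*}

/-- The element of index `j` and value `k` of a lexicographic sum. -/
def lexMk (j : J) (k : Q j) : Σₗ j, Q j := toLex ⟨j, k⟩

lemma exists_eq_lexMk (x : Σₗ j, Q j) : ∃ (j : J) (k : Q j), x = lexMk j k := ⟨_, _, rfl⟩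

variable [LinearOrder J] [∀ j, LinearOrder (Q j)]

lemma lexMk_le_lexMk {j : J} {k k' : Q j} (h : k ≤ k') : lexMk j k ≤ lexMk j k' :=
  Sigma.Lex.right _ _ h

lemma lexMk_lt_lexMk {j : J} {k k' : Q j} (h : k < k') : lexMk j k < lexMk j k' :=
  Sigma.Lex.right _ _ h

lemma lexMk_lt_lexMk_of_lt {j j' : J} (h : j < j') (k : Q j) (k' : Q j') :
    lexMk j k < lexMk j' k' :=
  Sigma.Lex.left _ _ h

lemma lexMk_lt_lexMk_iff {j : J} {k k' : Q j} : lexMk j k < lexMk j k' ↔ k < k' := by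
  refine ⟨fun h ↦ ?_, lexMk_lt_lexMk⟩
  by_contra h'
  exact (lexMk_le_lexMk (not_lt.1 h')).not_gt h

lemma lexMk_le_lexMk_iff {j : J} {k k' : Q j} : lexMk j k ≤ lexMk j k' ↔ k ≤ k' := by
  refine ⟨fun h ↦ ?_, lexMk_le_lexMk⟩
  by_contra h'
  exact (lexMk_lt_lexMk (not_le.1 h')).not_ge h

lemma le_of_lexMk_le_lexMk {j j' : J} {k : Q j} {k' : Q j'} (h : lexMk j k ≤ lexMk j' k') :
    j ≤ j' := by
  by_contra h'
  exact (lexMk_lt_lexMk_of_lt (not_le.1 h') k' k).not_ge h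

instance [WellFoundedLT J] [∀ j, WellFoundedLT (Q j)] : WellFoundedLT (Σₗ j, Q j) where
  wf := ⟨fun x ↦ by
    obtain ⟨j, k, rfl⟩ := exists_eq_lexMk x
    induction j using WellFoundedLT.induction with | _ j hj
    induction k using WellFoundedLT.induction with | _ k hk
    refine ⟨_, fun y hy ↦ ?_⟩
    obtain ⟨j', k', rfl⟩ := exists_eq_lexMk y
    obtain h | rfl := (le_of_lexMk_le_lexMk hy.le).lt_or_eq
    · exact hj _ h _
    · exact hk _ (lexMk_lt_lexMk_iff.1 hy)⟩

lemma covBy_of_lexMk_covBy {j : J} {k k' : Q j} (h : lexMk j k ⋖ lexMk j k') : k ⋖ k' :=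
  ⟨lexMk_lt_lexMk_iff.1 h.1, fun _ h₁ h₂ ↦ h.2 (lexMk_lt_lexMk h₁) (lexMk_lt_lexMk h₂)⟩

lemma lexMk_covBy {j : J} {k k' : Q j} (h : k ⋖ k') : lexMk j k ⋖ lexMk j k' := by
  refine ⟨lexMk_lt_lexMk h.1, fun c hc hc' ↦ ?_⟩
  obtain ⟨i, l, rfl⟩ := exists_eq_lexMk c
  obtain rfl := le_antisymm (le_of_lexMk_le_lexMk hc.le) (le_of_lexMk_le_lexMk hc'.le)
  exact h.2 (lexMk_lt_lexMk_iff.1 hc) (lexMk_lt_lexMk_iff.1 hc')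

lemma lexMk_covBy_lexMk_bot [∀ j, OrderBot (Q j)] {j j' : J} (h : j ⋖ j') {k : Q j}
    (hk : IsMax k) : lexMk j k ⋖ lexMk j' ⊥ := by
  refine ⟨lexMk_lt_lexMk_of_lt h.1 _ _, fun c hc hc' ↦ ?_⟩
  obtain ⟨i, l, rfl⟩ := exists_eq_lexMk c
  obtain h₁ | rfl := (le_of_lexMk_le_lexMk hc.le).lt_or_eq
  · obtain rfl := ((le_of_lexMk_le_lexMk hc'.le).lt_or_eq).resolve_left (h.2 h₁)
    exact not_lt_bot (lexMk_lt_lexMk_iff.1 hc')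
  · exact hk.not_lt (lexMk_lt_lexMk_iff.1 hc)

/-- Between different summands, an element is covered only if it is the largest of its summand. -/
lemma isMax_and_eq_bot_of_lexMk_covBy [∀ j, OrderBot (Q j)] [SuccOrder J] {j j' : J}
    (hj : j < j') {k : Q j} {k' : Q j'} (h : lexMk j k ⋖ lexMk j' k') :
    IsMax k ∧ j' = Order.succ j ∧ k' = ⊥ := by
  refine ⟨?_, ?_, ?_⟩
  · rw [isMax_iff_forall_not_lt]
    exact fun l hl ↦ h.2 (lexMk_lt_lexMk hl) (lexMk_lt_lexMk_of_lt hj _ _)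
  · refine le_antisymm ?_ (Order.succ_le_of_lt hj)
    by_contra! h'
    exact h.2 (lexMk_lt_lexMk_of_lt (Order.lt_succ_of_not_isMax hj.not_isMax) k ⊥)
      (lexMk_lt_lexMk_of_lt h' _ _)
  · by_contra h'
    exact h.2 (lexMk_lt_lexMk_of_lt hj k ⊥) (lexMk_lt_lexMk (bot_lt_iff_ne_bot.2 h'))

end LexicographicSums

section Flattening

variable {D : Type*} [Category* D] {J : Type*} [LinearOrder J] [SuccOrder J] (G : J ⥤ D)

/-- A refinement of the functor `G : J ⥤ D`: a functor `F j` from a well-ordered type for each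
`j`, that interpolates between `G.obj j` and `G.obj (Order.succ j)`. -/
structure Refinement (Q : J → Type*) [∀ j, LinearOrder (Q j)] [∀ j, OrderBot (Q j)] where
  F (j : J) : Q j ⥤ D
  isoBot (j : J) : G.obj j ≅ (F j).obj ⊥
  incl (j : J) (k : Q j) : (F j).obj k ⟶ G.obj (Order.succ j)
  map_incl (j : J) {k k' : Q j} (φ : k ⟶ k') : (F j).map φ ≫ incl j k' = incl j k
  fac (j : J) : (isoBot j).hom ≫ incl j ⊥ = G.map (homOfLE (Order.le_succ j))

namespace Refinement

variable {G} {Q : J → Type*} [∀ j, LinearOrder (Q j)] [∀ j, OrderBot (Q j)] (R : Refinement G Q)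

/-- The map between two terms of a refinement that belong to different summands. -/
def trans {j j' : J} (h : j < j') (k : Q j) (k' : Q j') : (R.F j).obj k ⟶ (R.F j').obj k' :=
  R.incl j k ≫ G.map (homOfLE (Order.succ_le_of_lt h)) ≫ (R.isoBot j').hom ≫
    (R.F j').map (homOfLE bot_le)

lemma map_trans {j j' : J} (h : j < j') {k l : Q j} (φ : k ⟶ l) (k' : Q j') :
    (R.F j).map φ ≫ R.trans h l k' = R.trans h k k' := by
  rw [trans, trans, ← Category.assoc, R.map_incl]

lemma trans_map {j j' : J} (h : j < j') (k : Q j) {k' l' : Q j'} (φ : k' ⟶ l') :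
    R.trans h k k' ≫ (R.F j').map φ = R.trans h k l' := by
  simp only [trans, Category.assoc, ← Functor.map_comp]
  rfl

lemma isoBot_map_incl (j : J) (k : Q j) :
    (R.isoBot j).hom ≫ (R.F j).map (homOfLE bot_le) ≫ R.incl j k =
      G.map (homOfLE (Order.le_succ j)) := by
  rw [R.map_incl, R.fac]

lemma isoBot_trans {j j' : J} (h : j < j') :
    (R.isoBot j).hom ≫ R.trans h ⊥ ⊥ = G.map (homOfLE h.le) ≫ (R.isoBot j').hom := by
  have : homOfLE (bot_le : (⊥ : Q j') ≤ ⊥) = 𝟙 _ := rfl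
  rw [trans, ← Category.assoc, R.fac, this, CategoryTheory.Functor.map_id, Category.comp_id,
    ← Category.assoc,
    ← G.map_comp]
  rfl

lemma trans_incl {j j' : J} (h : j < j') (k : Q j) (k' : Q j') :
    R.trans h k k' ≫ R.incl j' k' =
      R.incl j k ≫ G.map (homOfLE ((Order.succ_le_of_lt h).trans (Order.le_succ j'))) := by
  simp only [trans, Category.assoc, R.isoBot_map_incl, ← Functor.map_comp]
  rfl

lemma trans_trans {j j' j'' : J} (h : j < j') (h' : j' < j'') (k : Q j) (k' : Q j') (k'' : Q j'') :
    R.trans h k k' ≫ R.trans h' k' k'' = R.trans (h.trans h') k k'' := by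
  rw [show R.trans h' k' k'' = R.incl j' k' ≫ _ from rfl, ← Category.assoc, R.trans_incl,
    Category.assoc,
    ← Functor.map_comp_assoc]
  rfl

open Classical in
/-- The action on morphisms of the flattening of a refinement. -/
noncomputable def flatMap : ∀ (x y : Σ j, Q j), (toLex x ≤ toLex y) →
    ((R.F x.1).obj x.2 ⟶ (R.F y.1).obj y.2)
  | ⟨j, k⟩, ⟨j', k'⟩, h =>
    if e : j = j' then by
      subst e
      exact (R.F j).map (homOfLE (lexMk_le_lexMk_iff.1 h))
    else R.trans (lt_of_le_of_ne (le_of_lexMk_le_lexMk h) e) k k'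

lemma flatMap_same {j : J} {k k' : Q j} (h : k ≤ k') :
    R.flatMap ⟨j, k⟩ ⟨j, k'⟩ (lexMk_le_lexMk h) = (R.F j).map (homOfLE h) := by
  simp [flatMap]

lemma flatMap_of_lt {j j' : J} (h : j < j') (k : Q j) (k' : Q j') :
    R.flatMap ⟨j, k⟩ ⟨j', k'⟩ (lexMk_lt_lexMk_of_lt h k k').le = R.trans h k k' := by
  simp [flatMap, h.ne]

/-- The data of a functor from the lexicographic sum that restricts to the terms of a
refinement. -/
structure Flattening where
  H : (Σₗ j, Q j) ⥤ D
  iso (j : J) (k : Q j) : (R.F j).obj k ≅ H.obj (lexMk j k)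
  iso_map (j : J) {k k' : Q j} (h : k ≤ k') :
    (iso j k).hom ≫ H.map (homOfLE (lexMk_le_lexMk h)) =
      (R.F j).map (homOfLE h) ≫ (iso j k').hom
  iso_map_of_lt {j j' : J} (h : j < j') (k : Q j) (k' : Q j') :
    (iso j k).hom ≫ H.map (homOfLE (lexMk_lt_lexMk_of_lt h k k').le) =
      R.trans h k k' ≫ (iso j' k').hom

lemma nonempty_flattening : Nonempty R.Flattening := by
  let H : (Σₗ j, Q j) ⥤ D :=
    { obj := fun x ↦ (R.F (ofLex x).1).obj (ofLex x).2
      map := fun {x y} φ ↦ R.flatMap (ofLex x) (ofLex y) (leOfHom φ)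
      map_id := by
        rintro ⟨j, k⟩
        exact (R.flatMap_same le_rfl).trans ((R.F j).map_id k)
      map_comp := by
        rintro ⟨j, k⟩ ⟨j', k'⟩ ⟨j'', k''⟩ φ φ'
        have h := leOfHom φ
        have h' := leOfHom φ'
        obtain hj | rfl := (le_of_lexMk_le_lexMk h).lt_or_eq <;>
          obtain hj' | rfl := (le_of_lexMk_le_lexMk h').lt_or_eq
        · exact (R.flatMap_of_lt (hj.trans hj') _ _).trans ((R.trans_trans hj hj' _ _ _).symm.trans
            (congr_arg₂ (· ≫ ·) (R.flatMap_of_lt hj _ _).symm (R.flatMap_of_lt hj' _ _).symm))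
        · exact (R.flatMap_of_lt hj _ _).trans ((R.trans_map hj _
            (homOfLE (lexMk_le_lexMk_iff.1 h'))).symm.trans
            (congr_arg₂ (· ≫ ·) (R.flatMap_of_lt hj _ _).symm
              (R.flatMap_same (lexMk_le_lexMk_iff.1 h')).symm))
        · exact (R.flatMap_of_lt hj' _ _).trans ((R.map_trans hj'
            (homOfLE (lexMk_le_lexMk_iff.1 h)) _).symm.trans
            (congr_arg₂ (· ≫ ·) (R.flatMap_same (lexMk_le_lexMk_iff.1 h)).symm
              (R.flatMap_of_lt hj' _ _).symm))
        · exact (R.flatMap_same ((lexMk_le_lexMk_iff.1 h).trans (lexMk_le_lexMk_iff.1 h'))).trans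
            (((R.F j).map_comp (homOfLE (lexMk_le_lexMk_iff.1 h))
              (homOfLE (lexMk_le_lexMk_iff.1 h'))).trans
            (congr_arg₂ (· ≫ ·) (R.flatMap_same (lexMk_le_lexMk_iff.1 h)).symm
              (R.flatMap_same (lexMk_le_lexMk_iff.1 h')).symm)) }
  refine ⟨⟨H, fun j k ↦ Iso.refl _, fun j k k' h ↦ ?_, fun {j j'} h k k' ↦ ?_⟩⟩
  · exact (Category.id_comp _).trans ((R.flatMap_same h).trans (Category.comp_id _).symm)
  · exact (Category.id_comp _).trans ((R.flatMap_of_lt h k k').trans (Category.comp_id _).symm)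

namespace Flattening

variable {R} (Φ : R.Flattening)

/-- The terms of `G` are the first terms of the summands. -/
def isoG (j : J) : G.obj j ≅ Φ.H.obj (lexMk j ⊥) := R.isoBot j ≪≫ Φ.iso j ⊥

lemma isoG_map {j j' : J} (h : j ≤ j') :
    (Φ.isoG j).hom ≫ Φ.H.map (homOfLE (by
      obtain h | rfl := h.lt_or_eq
      · exact (lexMk_lt_lexMk_of_lt h _ _).le
      · exact le_rfl)) = G.map (homOfLE h) ≫ (Φ.isoG j').hom := by
  obtain h | rfl := h.lt_or_eq
  · rw [isoG, Iso.trans_hom, Category.assoc, Φ.iso_map_of_lt h, ← Category.assoc, R.isoBot_trans]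
    simp [isoG]
  · have h₁ : homOfLE (le_refl (lexMk j (⊥ : Q j))) = 𝟙 _ := rfl
    have h₂ : homOfLE h = 𝟙 _ := rfl
    rw [h₁, h₂, CategoryTheory.Functor.map_id, CategoryTheory.Functor.map_id,
      Category.comp_id, Category.id_comp]

variable [NoMaxOrder J]

lemma iso_map_lexMk_succ (j : J) (k : Q j) :
    (Φ.iso j k).hom ≫ Φ.H.map (homOfLE (lexMk_lt_lexMk_of_lt (Order.lt_succ j) k ⊥).le) =
      R.incl j k ≫ (Φ.isoG (Order.succ j)).hom := by
  have h₁ : homOfLE (Order.succ_le_of_lt (Order.lt_succ j)) = 𝟙 _ := rfl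
  have h₂ : homOfLE (bot_le : (⊥ : Q (Order.succ j)) ≤ ⊥) = 𝟙 _ := rfl
  rw [Φ.iso_map_of_lt (Order.lt_succ j), Refinement.trans, h₁, h₂,
    CategoryTheory.Functor.map_id, CategoryTheory.Functor.map_id]
  simp [isoG]

include Φ in
/-- The flattening of a refinement is continuous if `G` and the terms of the refinement are, and
if the summands without a largest element converge to the next term of `G`. -/
lemma isWellOrderContinuous [G.IsWellOrderContinuous] [∀ j, (R.F j).IsWellOrderContinuous]
    (hdesc : ∀ j, (∀ k : Q j, ¬ IsMax k) → ∀ (Z : D) (f : ∀ k, (R.F j).obj k ⟶ Z),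
      (∀ k k' (h : k ≤ k'), (R.F j).map (homOfLE h) ≫ f k' = f k) →
      ∃ g : G.obj (Order.succ j) ⟶ Z, ∀ k, R.incl j k ≫ g = f k)
    (hext : ∀ j, (∀ k : Q j, ¬ IsMax k) → ∀ (Z : D) (f g : G.obj (Order.succ j) ⟶ Z),
      (∀ k, R.incl j k ≫ f = R.incl j k ≫ g) → f = g) :
    Φ.H.IsWellOrderContinuous := by
  have hcases (m : Σₗ j, Q j) (hm : Order.IsSuccLimit m) :
      (∃ (j : J) (k : Q j), m = lexMk j k ∧ Order.IsSuccLimit k) ∨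
      (∃ j : J, m = lexMk j ⊥ ∧ Order.IsSuccLimit j) ∨
      (∃ j : J, m = lexMk (Order.succ j) ⊥ ∧ ∀ k : Q j, ¬ IsMax k) := by
    obtain ⟨j, k, rfl⟩ := exists_eq_lexMk m
    by_cases hk : k = ⊥
    · subst hk
      right
      by_cases hj : Order.IsSuccPrelimit j
      · refine Or.inl ⟨j, rfl, ⟨fun hj' ↦ hm.1 fun y hy ↦ ?_, hj⟩⟩
        obtain ⟨i, l, rfl⟩ := exists_eq_lexMk y
        obtain h | rfl := (le_of_lexMk_le_lexMk hy).lt_or_eq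
        · exact (hj'.not_lt h).elim
        · exact lexMk_le_lexMk bot_le
      · simp only [Order.IsSuccPrelimit, not_forall, not_not] at hj
        obtain ⟨i, hi⟩ := hj
        obtain rfl := hi.succ_eq
        exact Or.inr ⟨i, rfl, fun k hk ↦ hm.2 _ (lexMk_covBy_lexMk_bot hi hk)⟩
    · exact Or.inl ⟨j, k, rfl, fun h ↦ hk h.eq_bot, fun l hl ↦ hm.2 _ (lexMk_covBy hl)⟩
  refine Φ.H.isWellOrderContinuous_of_exists_desc (fun m hm Z f hf ↦ ?_) (fun m hm Z f g h ↦ ?_)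
  · suffices ∃ g : Φ.H.obj m ⟶ Z, ∀ a (ha : a < m), ∃ (b : _) (hb : b < m), a ≤ b ∧
        Φ.H.map (homOfLE hb.le) ≫ g = f b hb by
      obtain ⟨g, hg⟩ := this
      refine ⟨g, fun a ha ↦ ?_⟩
      obtain ⟨b, hb, hab, h⟩ := hg a ha
      rw [← hf a b hab hb, ← h, ← Functor.map_comp_assoc]
      rfl
    obtain ⟨j, k, rfl, hk⟩ | ⟨j, rfl, hj⟩ | ⟨j, rfl, hj⟩ := hcases m hm
    · obtain ⟨g, hg⟩ := (R.F j).exists_desc_of_isSuccLimit hk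
        (fun l hl ↦ (Φ.iso j l).hom ≫ f (lexMk j l) (lexMk_lt_lexMk hl)) (fun l l' hll' hl' ↦ by
          rw [← hf _ _ (lexMk_le_lexMk hll') (lexMk_lt_lexMk hl'), ← Category.assoc,
            ← Category.assoc, Φ.iso_map])
      have hg' (l : Q j) (hl : l < k) : Φ.H.map (homOfLE (lexMk_lt_lexMk hl).le) ≫
          (Φ.iso j k).inv ≫ g = f (lexMk j l) (lexMk_lt_lexMk hl) := by
        rw [← cancel_epi (Φ.iso j l).hom, ← hg l hl, ← Category.assoc, Φ.iso_map j hl.le]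
        simp
      refine ⟨(Φ.iso j k).inv ≫ g, fun a ha ↦ ?_⟩
      obtain ⟨i, l, rfl⟩ := exists_eq_lexMk a
      obtain h | rfl := (le_of_lexMk_le_lexMk ha.le).lt_or_eq
      · exact ⟨lexMk j ⊥, _, (lexMk_lt_lexMk_of_lt h _ _).le, hg' _ hk.bot_lt⟩
      · exact ⟨_, _, le_rfl, hg' l (lexMk_lt_lexMk_iff.1 ha)⟩
    · obtain ⟨g, hg⟩ := G.exists_desc_of_isSuccLimit hj
        (fun i hi ↦ (Φ.isoG i).hom ≫ f (lexMk i ⊥) (lexMk_lt_lexMk_of_lt hi _ _))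
        (fun i i' hii' hi' ↦ by
          rw [← Category.assoc, ← Φ.isoG_map hii', Category.assoc, hf])
      refine ⟨(Φ.isoG j).inv ≫ g, fun a ha ↦ ?_⟩
      obtain ⟨i, l, rfl⟩ := exists_eq_lexMk a
      obtain h | rfl := (le_of_lexMk_le_lexMk ha.le).lt_or_eq
      · have hi : Order.succ i < j := hj.succ_lt h
        refine ⟨lexMk (Order.succ i) ⊥, lexMk_lt_lexMk_of_lt hi _ _,
          (lexMk_lt_lexMk_of_lt (Order.lt_succ i) _ _).le, ?_⟩
        rw [← cancel_epi (Φ.isoG _).hom, ← hg _ hi, ← Category.assoc, Φ.isoG_map hi.le]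
        simp
      · exact (not_lt_bot (lexMk_lt_lexMk_iff.1 ha)).elim
    · have hlt (k : Q j) := lexMk_lt_lexMk_of_lt (Order.lt_succ j) k (⊥ : Q (Order.succ j))
      obtain ⟨g, hg⟩ := hdesc j hj Z (fun k ↦ (Φ.iso j k).hom ≫ f (lexMk j k) (hlt k))
        (fun k k' h ↦ by
          rw [← hf _ _ (lexMk_le_lexMk h) (hlt k'), ← Category.assoc, ← Category.assoc,
            Φ.iso_map])
      have hg' (k : Q j) : Φ.H.map (homOfLE (hlt k).le) ≫ (Φ.isoG _).inv ≫ g =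
          f (lexMk j k) (hlt k) := by
        rw [← cancel_epi (Φ.iso j k).hom, ← hg k, ← Category.assoc, Φ.iso_map_lexMk_succ]
        simp
      refine ⟨(Φ.isoG _).inv ≫ g, fun a ha ↦ ?_⟩
      obtain ⟨i, l, rfl⟩ := exists_eq_lexMk a
      obtain h | rfl := (le_of_lexMk_le_lexMk ha.le).lt_or_eq
      · obtain h | rfl := (Order.le_of_lt_succ h).lt_or_eq
        · exact ⟨lexMk j ⊥, _, (lexMk_lt_lexMk_of_lt h _ _).le, hg' _⟩
        · exact ⟨_, _, le_rfl, hg' l⟩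
      · exact (not_lt_bot (lexMk_lt_lexMk_iff.1 ha)).elim
  · obtain ⟨j, k, rfl, hk⟩ | ⟨j, rfl, hj⟩ | ⟨j, rfl, hj⟩ := hcases m hm
    · rw [← cancel_epi (Φ.iso j k).hom]
      refine (R.F j).hom_ext_of_isSuccLimit hk (fun l hl ↦ ?_)
      rw [← Category.assoc, ← Category.assoc, ← Φ.iso_map, Category.assoc, Category.assoc,
        h _ (lexMk_lt_lexMk hl)]
    · rw [← cancel_epi (Φ.isoG j).hom]
      refine G.hom_ext_of_isSuccLimit hj (fun i hi ↦ ?_)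
      rw [← Category.assoc, ← Category.assoc, ← Φ.isoG_map, Category.assoc, Category.assoc,
        h _ (lexMk_lt_lexMk_of_lt hi _ _)]
    · rw [← cancel_epi (Φ.isoG _).hom]
      refine hext j hj _ _ _ (fun k ↦ ?_)
      rw [← Category.assoc, ← Category.assoc, ← Φ.iso_map_lexMk_succ, Category.assoc,
        Category.assoc, h _ (lexMk_lt_lexMk_of_lt (Order.lt_succ j) _ _)]

lemma map_mem_of_covBy {W : MorphismProperty D} [W.RespectsIso]
    (hF : ∀ (j : J) {k k' : Q j} (h : k ⋖ k'), W ((R.F j).map (homOfLE h.le)))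
    (hincl : ∀ (j : J) (k : Q j), IsMax k → W (R.incl j k)) {x y : Σₗ j, Q j} (h : x ⋖ y) :
    W (Φ.H.map (homOfLE h.le)) := by
  obtain ⟨j, k, rfl⟩ := exists_eq_lexMk x
  obtain ⟨j', k', rfl⟩ := exists_eq_lexMk y
  obtain hj | rfl := (le_of_lexMk_le_lexMk h.le).lt_or_eq
  · obtain ⟨hk, rfl, rfl⟩ := isMax_and_eq_bot_of_lexMk_covBy hj h
    rw [← W.cancel_left_of_respectsIso (Φ.iso j k).hom, Φ.iso_map_lexMk_succ,
      W.cancel_right_of_respectsIso]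
    exact hincl j k hk
  · have h' := covBy_of_lexMk_covBy h
    rw [← W.cancel_left_of_respectsIso (Φ.iso j k).hom, Φ.iso_map j h'.le,
      W.cancel_right_of_respectsIso]
    exact hF j h'

end Flattening

end Refinement

end Flattening

section Embedding

variable {C : Type u} [Category.{v} C] {D : Type u'} [Category.{v'} D] (ι : C ⥤ D)
  (I : MorphismProperty C)

/-- The pushouts in `D` of images of morphisms in `I`. -/
abbrev imagePushouts : MorphismProperty D := (I.strictMap ι).pushouts

/-- The morphisms that are pushouts of images of morphisms in `I` if their source is in the
essential image of `ι`. -/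
def imagePushoutsOnEssImage : MorphismProperty D :=
  fun X _ f ↦ ι.essImage X → imagePushouts ι I f

instance : (imagePushoutsOnEssImage ι I).RespectsIso := by
  refine MorphismProperty.RespectsIso.of_respects_arrow_iso _ (fun f g e hf hX ↦ ?_)
  exact (MorphismProperty.arrow_mk_iso_iff (imagePushouts ι I) e).1
    (hf (Functor.essImage.ofIso (Arrow.leftFunc.mapIso e).symm hX))

variable {ι I}

lemma exists_lift_of_essImage [ι.Full] [ι.Faithful] {K : Type*} [Category* K] (F : K ⥤ D)
    (hF : ∀ k, ι.essImage (F.obj k)) : ∃ F' : K ⥤ C, Nonempty (F' ⋙ ι ≅ F) := by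
  choose X e using hF
  replace e k := (e k).some
  let F' : K ⥤ C :=
    { obj := X
      map := fun {k l} φ ↦ ι.preimage ((e k).hom ≫ F.map φ ≫ (e l).inv)
      map_id := fun k ↦ ι.map_injective (by simp)
      map_comp := fun φ ψ ↦ ι.map_injective (by simp) }
  exact ⟨F', ⟨NatIso.ofComponents e (fun φ ↦ by simp [F'])⟩⟩

lemma isWellOrderContinuous_of_comp [ι.Full] [ι.Faithful] {K : Type*} [PartialOrder K] (F : K ⥤ C)
    [(F ⋙ ι).IsWellOrderContinuous] : F.IsWellOrderContinuous := by
  refine F.isWellOrderContinuous_of_exists_desc (fun m hm Z f hf ↦ ?_) (fun m hm Z f g h ↦ ?_)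
  · obtain ⟨g, hg⟩ := (F ⋙ ι).exists_desc_of_isSuccLimit hm (fun a ha ↦ ι.map (f a ha))
      (fun a b hab hb ↦ by rw [← hf a b hab hb, ι.map_comp]; rfl)
    refine ⟨ι.preimage g, fun a ha ↦ ι.map_injective ?_⟩
    rw [ι.map_comp, ι.map_preimage]
    exact hg a ha
  · refine ι.map_injective ((F ⋙ ι).hom_ext_of_isSuccLimit hm (fun a ha ↦ ?_))
    exact (ι.map_comp _ _).symm.trans ((congr_arg ι.map (h a ha)).trans (ι.map_comp _ _))

lemma pushouts_of_imagePushouts [ι.Full] [ι.Faithful] {X Y : C} (f : X ⟶ Y)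
    (hf : imagePushouts ι I (ι.map f)) : I.pushouts f := by
  obtain ⟨A, B, i, a, b, hi, sq⟩ := hf
  obtain @⟨A, B, i, hi⟩ := hi
  obtain ⟨a, rfl⟩ := ι.map_surjective a
  obtain ⟨b, rfl⟩ := ι.map_surjective b
  exact ⟨A, B, i, a, b, hi, sq.of_map ι (ι.map_injective (by simpa using sq.w))⟩

lemma essImage_of_imagePushouts [ι.Full] [ι.Faithful] [PreservesColimitsOfShape WalkingSpan ι]
    (hI : ∀ {A B X : C} (i : A ⟶ B) (a : A ⟶ X), I i → HasPushout i a) {X Y : D} {f : X ⟶ Y}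
    (hf : imagePushouts ι I f) (hX : ι.essImage X) : ι.essImage Y := by
  obtain ⟨A, B, i, a, b, hi, sq⟩ := hf
  obtain @⟨A, B, i, hi⟩ := hi
  obtain ⟨X', ⟨e⟩⟩ := hX
  obtain ⟨a', ha'⟩ := ι.map_surjective (a ≫ e.inv)
  have := hI i a' hi
  have sq₁ : IsPushout (ι.map i) a (ι.map (pushout.inl i a')) (e.inv ≫ ι.map (pushout.inr i a')) :=
    ((IsPushout.of_hasPushout i a').map ι).of_iso (Iso.refl _) (Iso.refl _) e (Iso.refl _)
      (by simp) (by simp [ha']) (by simp) (by simp)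
  exact ⟨_, ⟨sq₁.isoIsPushout _ _ sq.flip⟩⟩

lemma exists_isSequenceOfMorphisms [ι.Full] [ι.Faithful] {K : Type v} [LinearOrder K] [OrderBot K]
    [SuccOrder K] [WellFoundedLT K] (F : K ⥤ D) [F.IsWellOrderContinuous]
    (hF : ∀ k, ι.essImage (F.obj k))
    (hF' : ∀ {a b : K} (h : a ⋖ b), imagePushoutsOnEssImage ι I (F.map (homOfLE h.le))) :
    ∃ F' : K ⥤ C, Nonempty (F' ⋙ ι ≅ F) ∧ IsSequenceOfMorphisms I.pushouts F' := by
  obtain ⟨F', ⟨e⟩⟩ := exists_lift_of_essImage (ι := ι) F hF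
  have : (F' ⋙ ι).IsWellOrderContinuous := Functor.isWellOrderContinuous_of_iso e.symm
  refine ⟨F', ⟨e⟩, isWellOrderContinuous_of_comp (ι := ι) F', fun j hj ↦ ?_⟩
  refine pushouts_of_imagePushouts (ι := ι) _ ?_
  exact (MorphismProperty.arrow_mk_iso_iff (imagePushouts ι I)
    (((Functor.mapArrowFunctor _ _).mapIso e).app (Arrow.mk (homOfLE (Order.le_succ j))))).2
      (hF' (Order.covBy_succ_of_not_isMax hj) (hF j))

/-- A continuous sequence of pushouts of images of morphisms in `I` that starts in the essential
image of `ι` stays there. -/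
lemma essImage_of_isWellOrderContinuous [ι.Full] [ι.Faithful] [PreservesColimitsOfSize.{v, v} ι]
    [PreservesColimitsOfShape WalkingSpan ι]
    (hI : ∀ {A B X : C} (i : A ⟶ B) (a : A ⟶ X), I i → HasPushout i a)
    (hI' : ∀ (K : Type v) [LinearOrder K] [OrderBot K] [SuccOrder K] [WellFoundedLT K] (F : K ⥤ C),
      IsSequenceOfMorphisms I.pushouts F → HasColimit F)
    {K : Type v} [LinearOrder K] [OrderBot K] [SuccOrder K] [WellFoundedLT K] (F : K ⥤ D)
    [F.IsWellOrderContinuous] (hF : ι.essImage (F.obj ⊥))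
    (hF' : ∀ {a b : K} (h : a ⋖ b), imagePushoutsOnEssImage ι I (F.map (homOfLE h.le))) (k : K) :
    ι.essImage (F.obj k) := by
  induction k using SuccOrder.limitRecOn with
  | isMin k hk =>
    obtain rfl := hk.eq_bot
    exact hF
  | succ k hk hk' =>
    exact essImage_of_imagePushouts hI (hF' (Order.covBy_succ_of_not_isMax hk) hk') hk'
  | isSuccLimit m hm hm' =>
    let : OrderBot (Set.Iio m) := { bot := ⟨⊥, hm.bot_lt⟩, bot_le := fun _ ↦ bot_le }
    let : SuccOrder (Set.Iio m) := SuccOrder.ofLinearWellFoundedLT _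
    let F₀ : Set.Iio m ⥤ D := (Set.principalSegIio m).monotone.functor ⋙ F
    have : F₀.IsWellOrderContinuous :=
      inferInstanceAs (((Set.principalSegIio m : Set.Iio m ≤i K).monotone.functor ⋙
        F).IsWellOrderContinuous)
    obtain ⟨F', ⟨e⟩, h⟩ := exists_isSequenceOfMorphisms (ι := ι) (I := I) F₀
      (fun k ↦ hm' k.1 k.2) (fun {a b} h ↦ hF' (a := a.1) (b := b.1)
        ⟨h.1, fun c hc hc' ↦ h.2 (c := ⟨c, hc'.trans b.2⟩) hc hc'⟩)
    have := hI' _ F' h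
    have h₁ := isColimitOfPreserves ι (colimit.isColimit F')
    have h₂ := F.isColimitOfIsWellOrderContinuous m hm
    exact ⟨colimit F', ⟨IsColimit.coconePointsIsoOfNatIso h₁ h₂ e⟩⟩

end Embedding

section Attachments

variable {D : Type u} [Category.{v} D] {X : D} {Q : Type w} {A B : Q → D}
  (i : ∀ s, A s ⟶ B s) (g : ∀ s, A s ⟶ X)

/-- The objects obtained from `X` by attaching the cells `i s` along `g s` for all `s` in a
subset `U`, functorially in `U`. -/
structure Attachments where
  Φ : Set Q ⥤ D
  x (U : Set Q) : X ⟶ Φ.obj U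
  y {U : Set Q} (s : Q) (hs : s ∈ U) : B s ⟶ Φ.obj U
  w {U : Set Q} (s : Q) (hs : s ∈ U) : g s ≫ x U = i s ≫ y s hs
  x_map {U V : Set Q} (φ : U ⟶ V) : x U ≫ Φ.map φ = x V
  y_map {U V : Set Q} (φ : U ⟶ V) (s : Q) (hs : s ∈ U) :
    y s hs ≫ Φ.map φ = y s (leOfHom φ hs)
  exists_desc {U : Set Q} {Z : D} (x' : X ⟶ Z) (y' : ∀ s ∈ U, B s ⟶ Z) :
    (∀ s hs, g s ≫ x' = i s ≫ y' s hs) →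
      ∃ h : Φ.obj U ⟶ Z, x U ≫ h = x' ∧ ∀ s hs, y s hs ≫ h = y' s hs
  hom_ext {U : Set Q} {Z : D} {h h' : Φ.obj U ⟶ Z} :
    x U ≫ h = x U ≫ h' → (∀ s (hs : s ∈ U), y s hs ≫ h = y s hs ≫ h') → h = h'

lemma exists_attachment [HasCoproducts.{w} D] [HasPushouts D] (U : Set Q) :
    ∃ (P : D) (x : X ⟶ P) (y : ∀ s ∈ U, B s ⟶ P), (∀ s hs, g s ≫ x = i s ≫ y s hs) ∧
      (∀ (Z : D) (x' : X ⟶ Z) (y' : ∀ s ∈ U, B s ⟶ Z), (∀ s hs, g s ≫ x' = i s ≫ y' s hs) →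
        ∃ h : P ⟶ Z, x ≫ h = x' ∧ ∀ s hs, y s hs ≫ h = y' s hs) ∧
      (∀ (Z : D) (h h' : P ⟶ Z), x ≫ h = x ≫ h' →
        (∀ s hs, y s hs ≫ h = y s hs ≫ h') → h = h') := by
  let a : (∐ fun s : U ↦ A s) ⟶ ∐ fun s : U ↦ B s := Limits.Sigma.map (fun s ↦ i s)
  let b : (∐ fun s : U ↦ A s) ⟶ X := Limits.Sigma.desc (fun s ↦ g s)
  refine ⟨pushout a b, pushout.inr a b, fun s hs ↦ Sigma.ι (fun s : U ↦ B s) ⟨s, hs⟩ ≫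
    pushout.inl a b, fun s hs ↦ ?_, fun Z x' y' h ↦ ?_, fun Z h h' hx hy ↦ ?_⟩
  · have h := Sigma.ι (fun s : U ↦ A s) ⟨s, hs⟩ ≫= pushout.condition (f := a) (g := b)
    simpa [a, b] using h.symm
  · have w : a ≫ Limits.Sigma.desc (fun s ↦ y' s.1 s.2) = b ≫ x' := by
      ext ⟨s, hs⟩
      simp [a, b, h s hs]
    exact ⟨pushout.desc (Limits.Sigma.desc (fun s ↦ y' s.1 s.2)) x' w, pushout.inr_desc _ _ _,
      fun s hs ↦ by
        rw [Category.assoc, pushout.inl_desc]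
        exact Sigma.ι_desc _ (⟨s, hs⟩ : U)⟩
  · apply pushout.hom_ext
    · ext ⟨s, hs⟩
      simpa using hy s hs
    · exact hx

lemma nonempty_attachments [HasCoproducts.{w} D] [HasPushouts D] :
    Nonempty (Attachments i g) := by
  choose P x y w desc ext using fun U ↦ exists_attachment i g U
  have hmap {U V : Set Q} (h : U ≤ V) : ∃ f : P U ⟶ P V, x U ≫ f = x V ∧
      ∀ s hs, y U s hs ≫ f = y V s (h hs) := desc U _ _ _ (fun s hs ↦ w V s (h hs))
  choose f hfx hfy using @hmap
  let Φ : Set Q ⥤ D :=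
    { obj := P
      map := fun φ ↦ f (leOfHom φ)
      map_id := fun U ↦ ext U _ _ _ (by simp [hfx]) (fun s hs ↦ by simp [hfy])
      map_comp := fun {U V W} φ ψ ↦ ext U _ _ _ (by
          rw [← Category.assoc, hfx, hfx, hfx])
        (fun s hs ↦ by rw [← Category.assoc, hfy, hfy, hfy]) }
  exact ⟨⟨Φ, x, fun {U} s hs ↦ y U s hs, fun {U} s hs ↦ w U s hs, fun φ ↦ hfx _,
    fun φ s hs ↦ hfy _ s hs, fun {U Z} ↦ desc U Z, fun {U Z h h'} ↦ ext U Z h h'⟩⟩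

namespace Attachments

variable {i g} (T : Attachments i g)

/-- Attaching no cells does nothing. -/
lemma isIso_x_empty {U : Set Q} (hU : ∀ s, s ∉ U) : IsIso (T.x U) := by
  obtain ⟨h, hx, -⟩ := T.exists_desc (U := U) (𝟙 X) (fun s hs ↦ (hU s hs).elim)
    (fun s hs ↦ (hU s hs).elim)
  refine ⟨h, hx, T.hom_ext ?_ (fun s hs ↦ (hU s hs).elim)⟩
  rw [← Category.assoc, hx, Category.id_comp, Category.comp_id]

/-- Attaching one more cell is a pushout. -/
lemma isPushout {U V : Set Q} (φ : U ⟶ V) (s : Q) (hs : s ∈ V) (hs' : s ∉ U)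
    (hV : ∀ t ∈ V, t ∈ U ∨ t = s) :
    IsPushout (i s) (g s ≫ T.x U) (T.y s hs) (T.Φ.map φ) := by
  have w : i s ≫ T.y s hs = (g s ≫ T.x U) ≫ T.Φ.map φ := by
    rw [Category.assoc, T.x_map, T.w]
  have hdesc (c : PushoutCocone (i s) (g s ≫ T.x U)) :
      ∃ h : T.Φ.obj V ⟶ c.pt, T.y s hs ≫ h = c.inl ∧ T.Φ.map φ ≫ h = c.inr := by
    classical
    obtain ⟨h, hx, hy⟩ := T.exists_desc (U := V) (T.x U ≫ c.inr)
      (fun t ht ↦ if h : t ∈ U then T.y t h ≫ c.inr else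
        eqToHom (by rw [(hV t ht).resolve_left h]) ≫ c.inl) (fun t ht ↦ by
          split_ifs with h
          · rw [← Category.assoc, ← Category.assoc]
            exact congr_arg (· ≫ c.inr) (T.w t h)
          · obtain rfl := (hV t ht).resolve_left h
            simpa using c.condition.symm)
    refine ⟨h, ?_, T.hom_ext ?_ (fun t ht ↦ ?_)⟩
    · rw [hy, dif_neg hs', eqToHom_refl, Category.id_comp]
    · rw [← Category.assoc, T.x_map, hx]
    · rw [← Category.assoc, T.y_map, hy, dif_pos ht]
  choose h hl hr using hdesc
  refine ⟨⟨w⟩, ⟨PushoutCocone.IsColimit.mk _ h hl hr (fun c m hm hm' ↦ T.hom_ext ?_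
    (fun t ht ↦ ?_))⟩⟩
  · rw [← T.x_map φ, Category.assoc, Category.assoc, hm', hr]
  · obtain ht' | rfl := hV t ht
    · rw [← T.y_map φ t ht', Category.assoc, Category.assoc, hm', hr]
    · rw [hm, hl]

variable {K : Type*} [Nonempty K] {U : K → Set Q} {V : Set Q}
  (hV : ∀ k, U k ≤ V) (hV' : ∀ s ∈ V, ∃ k, s ∈ U k)

include hV' in
/-- Attaching an increasing union of sets of cells is a colimit. -/
lemma exists_desc_of_union [LinearOrder K] (hU : Monotone U) {Z : D} (f : ∀ k, T.Φ.obj (U k) ⟶ Z)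
    (hf : ∀ k k' (h : k ≤ k'), T.Φ.map (homOfLE (hU h)) ≫ f k' = f k) :
    ∃ h : T.Φ.obj V ⟶ Z, ∀ k, T.Φ.map (homOfLE (hV k)) ≫ h = f k := by
  have hx (k k' : K) : T.x _ ≫ f k = T.x _ ≫ f k' := by
    wlog h : k ≤ k' generalizing k k'
    · exact (this k' k (le_of_not_ge h)).symm
    · rw [← hf k k' h, ← Category.assoc, T.x_map]
  have hy (k k' : K) (s : Q) (hs : s ∈ U k) (hs' : s ∈ U k') :
      T.y s hs ≫ f k = T.y s hs' ≫ f k' := by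
    wlog h : k ≤ k' generalizing k k'
    · exact (this k' k hs' hs (le_of_not_ge h)).symm
    · rw [← hf k k' h, ← Category.assoc, T.y_map]
  choose k hk using hV'
  let k₀ : K := Classical.arbitrary K
  obtain ⟨h, h₁, h₂⟩ := T.exists_desc (U := V) (T.x _ ≫ f k₀)
    (fun s hs ↦ T.y s (hk s hs) ≫ f (k s hs)) (fun s hs ↦ by
      rw [hx k₀ (k s hs), ← Category.assoc, ← Category.assoc, T.w])
  refine ⟨h, fun l ↦ T.hom_ext ?_ (fun s hs ↦ ?_)⟩
  · rw [← Category.assoc, T.x_map, h₁, hx]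
  · rw [← Category.assoc, T.y_map, h₂]
    exact hy _ _ _ _ _

include hV' in
lemma hom_ext_of_union {Z : D} {f f' : T.Φ.obj V ⟶ Z}
    (h : ∀ k, T.Φ.map (homOfLE (hV k)) ≫ f = T.Φ.map (homOfLE (hV k)) ≫ f') : f = f' := by
  refine T.hom_ext ?_ (fun s hs ↦ ?_)
  · have k₀ : K := Classical.arbitrary K
    rw [← T.x_map (homOfLE (hV k₀)), Category.assoc, Category.assoc, h]
  · obtain ⟨k, hk⟩ := hV' s hs
    rw [← T.y_map (homOfLE (hV k)) s hk, Category.assoc, Category.assoc, h]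

end Attachments

end Attachments

section CellSteps

variable {C : Type u} [Category.{v} C] {D : Type u'} [Category.{v'} D] (ι : C ⥤ D)
  (I : MorphismProperty C)

/-- A morphism `t : X ⟶ Y` that is a transfinite composition of pushouts of images of morphisms
in `I` and such that all morphisms to `X` from domains of morphisms in `I` extend to the codomains
after composition with `t`; if `X` is not in the essential image of `ι`, no condition is
imposed on these morphisms. -/
structure CellStep (X : D) where
  Y : D
  t : X ⟶ Y
  Q : Type v
  [linearOrder : LinearOrder Q]
  [orderBot : OrderBot Q]
  [wellFoundedLT : WellFoundedLT Q]
  F : Q ⥤ D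
  isWellOrderContinuous : F.IsWellOrderContinuous
  isoBot : X ≅ F.obj ⊥
  incl (k : Q) : F.obj k ⟶ Y
  map_incl {k k' : Q} (φ : k ⟶ k') : F.map φ ≫ incl k' = incl k
  fac : isoBot.hom ≫ incl ⊥ = t
  map_mem {k k' : Q} (h : k ⋖ k') : imagePushoutsOnEssImage ι I (F.map (homOfLE h.le))
  incl_mem (k : Q) : IsMax k → imagePushoutsOnEssImage ι I (incl k)
  exists_desc : (∀ k : Q, ¬ IsMax k) → ∀ (Z : D) (f : ∀ k, F.obj k ⟶ Z),
    (∀ k k' (h : k ≤ k'), F.map (homOfLE h) ≫ f k' = f k) →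
    ∃ h : Y ⟶ Z, ∀ k, incl k ≫ h = f k
  hom_ext : (∀ k : Q, ¬ IsMax k) → ∀ (Z : D) (f g : Y ⟶ Z),
    (∀ k, incl k ≫ f = incl k ≫ g) → f = g
  exists_extension : ι.essImage X → ∀ {A B : C} (i : A ⟶ B), I i → ∀ a : ι.obj A ⟶ X,
    ∃ b : ι.obj B ⟶ Y, ι.map i ≫ b = a ≫ t

attribute [instance] CellStep.linearOrder CellStep.orderBot CellStep.wellFoundedLT
  CellStep.isWellOrderContinuous

variable {ι I}

lemma nonempty_cellStep_of_not_essImage {X : D} (hX : ¬ ι.essImage X) :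
    Nonempty (CellStep ι I X) :=
  ⟨{ Y := X
     t := 𝟙 X
     Q := PUnit
     F := (Functor.const _).obj X
     isWellOrderContinuous := ⟨fun _ hm ↦ (hm.1 (fun _ _ ↦ le_rfl)).elim⟩
     isoBot := Iso.refl _
     incl := fun _ ↦ 𝟙 X
     map_incl := fun _ ↦ Category.id_comp _
     fac := Category.id_comp _
     map_mem := fun _ h ↦ (hX h).elim
     incl_mem := fun _ _ h ↦ (hX h).elim
     exists_desc := fun h ↦ (h PUnit.unit (fun _ _ ↦ le_rfl)).elim
     hom_ext := fun h ↦ (h PUnit.unit (fun _ _ ↦ le_rfl)).elim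
     exists_extension := fun h ↦ (hX h).elim }⟩

/-- All cells that can be attached to `X` can be attached one after another. -/
lemma nonempty_cellStep_of_essImage [ι.Full] [HasCoproducts.{v} D] [HasPushouts D]
    (hI : MorphismProperty.IsSmall.{v} I) (hI' : ∀ Z : C, ∃ (A B : C) (i : A ⟶ B) (_ : A ⟶ Z), I i)
    {X : D} (hX : ι.essImage X) : Nonempty (CellStep ι I X) := by
  obtain ⟨Z, ⟨e⟩⟩ := hX
  obtain ⟨S, A, B, i, rfl⟩ := (MorphismProperty.isSmall_iff_eq_ofHoms I).1 hI
  let Q : Type v := Σ s : S, (A s ⟶ Z)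
  have : Nonempty Q := by
    obtain ⟨A', B', i', a, hi'⟩ := hI' Z
    obtain ⟨s⟩ := hi'
    exact ⟨⟨s, a⟩⟩
  obtain ⟨_, _⟩ := exists_wellFoundedLT Q
  let := WellFoundedLT.toOrderBot Q
  obtain ⟨T⟩ := nonempty_attachments (X := X) (Q := Q) (fun q ↦ ι.map (i q.1))
    (fun q ↦ ι.map q.2 ≫ e.hom)
  have hmono : Monotone (Set.Iio : Q → Set Q) := fun a b h ↦ Set.Iio_subset_Iio h
  have hunion {m : Q} (hm : Order.IsSuccLimit m) (s : Q) (hs : s ∈ Set.Iio m) :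
      ∃ k : Set.Iio m, s ∈ Set.Iio k.1 := by
    have h : ¬ s ⋖ m := hm.2 s
    obtain ⟨k, hk, hk'⟩ := (not_covBy_iff hs).1 h
    exact ⟨⟨k, hk'⟩, hk⟩
  let F : Q ⥤ D := hmono.functor ⋙ T.Φ
  have hF : F.IsWellOrderContinuous := by
    refine F.isWellOrderContinuous_of_exists_desc (fun m hm Z f hf ↦ ?_) (fun m hm Z f g h ↦ ?_)
    · have : Nonempty (Set.Iio m) := ⟨⟨⊥, hm.bot_lt⟩⟩
      obtain ⟨g, hg⟩ := T.exists_desc_of_union (K := Set.Iio m) (U := fun k ↦ Set.Iio k.1)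
        (V := Set.Iio m) (fun k ↦ hmono k.2.le) (hunion hm) (fun k k' h ↦ hmono h)
        (fun k ↦ f k.1 k.2) (fun k k' h ↦ hf k.1 k'.1 h k'.2)
      exact ⟨g, fun a ha ↦ hg ⟨a, ha⟩⟩
    · have : Nonempty (Set.Iio m) := ⟨⟨⊥, hm.bot_lt⟩⟩
      exact T.hom_ext_of_union (K := Set.Iio m) (U := fun k ↦ Set.Iio k.1)
        (V := Set.Iio m) (fun k ↦ hmono k.2.le) (hunion hm) (fun k ↦ h k.1 k.2)
  have hbot : IsIso (T.x (Set.Iio ⊥)) := T.isIso_x_empty (fun s hs ↦ not_lt_bot hs)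
  have hpush {U V : Set Q} (φ : U ⟶ V) (s : Q) (hs : s ∈ V) (hs' : s ∉ U)
      (hV : ∀ t ∈ V, t ∈ U ∨ t = s) :
      imagePushoutsOnEssImage ι (MorphismProperty.ofHoms i) (T.Φ.map φ) := fun _ ↦
    MorphismProperty.pushouts_mk _ (T.isPushout φ s hs hs' hV).flip ⟨⟨s.1⟩⟩
  have htop (h : ∀ k : Q, ¬ IsMax k) (s : Q) (_ : s ∈ Set.univ) : ∃ k : Q, s ∈ Set.Iio k := by
    simpa [isMax_iff_forall_not_lt] using h s
  exact
   ⟨{ Y := T.Φ.obj Set.univ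
      t := T.x _
      Q := Q
      F := F
      isWellOrderContinuous := hF
      isoBot := @asIso _ _ _ _ (T.x (Set.Iio ⊥)) hbot
      incl := fun k ↦ T.Φ.map (homOfLE (Set.subset_univ _))
      map_incl := fun φ ↦ (T.Φ.map_comp _ _).symm
      fac := T.x_map _
      map_mem := fun {k k'} h ↦ hpush _ k h.lt (lt_irrefl k) (fun t ht ↦
        ((lt_or_eq_of_le (h.wcovBy.le_of_lt ht))))
      incl_mem := fun k hk ↦ hpush _ k (Set.mem_univ k) (lt_irrefl k) (fun t _ ↦
        lt_or_eq_of_le (hk.isTop t))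
      exists_desc := fun h Z f hf ↦ T.exists_desc_of_union (K := Q) (U := Set.Iio)
        (V := Set.univ) (fun k ↦ Set.subset_univ _) (htop h) hmono f hf
      hom_ext := fun h Z f g hfg ↦ T.hom_ext_of_union (K := Q) (U := Set.Iio)
        (V := Set.univ) (fun k ↦ Set.subset_univ _) (htop h) hfg
      exists_extension := fun _ A' B' i' hi' a ↦ by
        obtain ⟨s⟩ := hi'
        obtain ⟨b, hb⟩ := ι.map_surjective (a ≫ e.inv)
        refine ⟨T.y (⟨s, b⟩ : Q) (Set.mem_univ _), ?_⟩
        have := T.w (⟨s, b⟩ : Q) (Set.mem_univ _)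
        rw [← this, hb]
        simp }⟩

end CellSteps

section SmallObjectArgument

lemma cof_le_cof_sigmaLex {J : Type v} [LinearOrder J] {Q : J → Type v} [∀ j, LinearOrder (Q j)]
    [∀ j, OrderBot (Q j)] : Order.cof J ≤ Order.cof (Σₗ j, Q j) := by
  refine GaloisConnection.cof_le (f := fun j ↦ lexMk j ⊥) (g := fun x ↦ (ofLex x).1) ?_
  intro j x
  obtain ⟨i, k, rfl⟩ := exists_eq_lexMk x
  refine ⟨le_of_lexMk_le_lexMk, fun h ↦ ?_⟩
  obtain h | rfl := lt_or_eq_of_le h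
  · exact (lexMk_lt_lexMk_of_lt h _ _).le
  · exact lexMk_le_lexMk bot_le

variable {C : Type u} [Category.{v} C]

/-- Iterating the attachment of cells along a well-ordered type without a largest element, one
obtains a sequence of pushouts of morphisms in `I` along which all morphisms from domains of
morphisms in `I` can eventually be extended. -/
lemma exists_sequence_of_cellStep {D : Type u'} [Category.{v'} D] (ι : C ⥤ D) [ι.Full] [ι.Faithful]
    [PreservesColimitsOfSize.{v, v} ι] [PreservesColimitsOfShape WalkingSpan ι]
    [HasColimitsOfSize.{v, v} D] {I : MorphismProperty C} (step : ∀ X : D, CellStep ι I X)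
    (hI : ∀ {A B X : C} (i : A ⟶ B) (a : A ⟶ X), I i → HasPushout i a)
    (hI' : ∀ (K : Type v) [LinearOrder K] [OrderBot K] [SuccOrder K] [WellFoundedLT K] (F : K ⥤ C),
      IsSequenceOfMorphisms I.pushouts F → HasColimit F)
    (J : Type v) [LinearOrder J] [OrderBot J] [SuccOrder J] [WellFoundedLT J] [NoMaxOrder J]
    (A : C) :
    ∃ (K : Type v) (_ : LinearOrder K) (_ : OrderBot K) (_ : SuccOrder K) (_ : WellFoundedLT K)
      (F : K ⥤ C), Nonempty (F.obj ⊥ ≅ A) ∧ IsSequenceOfMorphisms I.pushouts F ∧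
        Order.cof J ≤ Order.cof K ∧
        ∀ (k : K) {X Y : C} (i : X ⟶ Y) (a : X ⟶ F.obj k), I i →
          ∃ (l : K) (h : k ≤ l) (b : Y ⟶ F.obj l), i ≫ b = a ≫ F.map (homOfLE h) := by
  let Ψ : SmallObject.SuccStruct D :=
    { X₀ := ι.obj A, succ X := (step X).Y, toSucc X := (step X).t }
  let G : J ⥤ D := Ψ.iterationFunctor J
  have hmax (j : J) : ¬ IsMax j := not_isMax j
  let e (j : J) : (step (G.obj j)).Y ≅ G.obj (Order.succ j) :=
    (Ψ.iterationFunctorObjSuccIso j (hmax j)).symm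
  have he (j : J) : G.map (homOfLE (Order.le_succ j)) = (step (G.obj j)).t ≫ (e j).hom :=
    Ψ.iterationFunctor_map_succ j (hmax j)
  have hG : G.IsWellOrderContinuous := inferInstanceAs (Ψ.iterationFunctor J).IsWellOrderContinuous
  let e₀ : G.obj ⊥ ≅ ι.obj A := Ψ.iterationFunctorObjBotIso J
  clear_value e₀ e G
  let R : Refinement G (fun j ↦ (step (G.obj j)).Q) :=
    { F := fun j ↦ (step (G.obj j)).F
      isoBot := fun j ↦ (step (G.obj j)).isoBot
      incl := fun j k ↦ (step (G.obj j)).incl k ≫ (e j).hom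
      map_incl := fun j k k' φ ↦ by rw [← Category.assoc, CellStep.map_incl]
      fac := fun j ↦ by rw [← Category.assoc, CellStep.fac, he] }
  obtain ⟨Φ⟩ := R.nonempty_flattening
  have (j : J) : (R.F j).IsWellOrderContinuous := (step (G.obj j)).isWellOrderContinuous
  have hΦ : Φ.H.IsWellOrderContinuous := Φ.isWellOrderContinuous
    (fun j hj Z f hf ↦ by
      obtain ⟨g, hg⟩ := (step (G.obj j)).exists_desc hj Z f hf
      refine ⟨(e j).inv ≫ g, fun k ↦ ?_⟩
      rw [← hg k]
      simp [R])
    (fun j hj Z f g h ↦ by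
      rw [← cancel_epi (e j).hom]
      refine (step (G.obj j)).hom_ext hj Z _ _ (fun k ↦ ?_)
      simpa [R] using h k)
  have hΦ' {a b : Σₗ j, (step (G.obj j)).Q} (h : a ⋖ b) :
      imagePushoutsOnEssImage ι I (Φ.H.map (homOfLE h.le)) :=
    Φ.map_mem_of_covBy (fun j k k' h ↦ (step (G.obj j)).map_mem h) (fun j k hk ↦
      (MorphismProperty.cancel_right_of_respectsIso _ _ _).2 ((step (G.obj j)).incl_mem k hk)) h
  let : SuccOrder (Σₗ j, (step (G.obj j)).Q) := SuccOrder.ofLinearWellFoundedLT _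
  let e₁ : Φ.H.obj ⊥ ≅ ι.obj A := (Φ.isoG ⊥).symm ≪≫ e₀
  have hess (x) : ι.essImage (Φ.H.obj x) :=
    essImage_of_isWellOrderContinuous hI hI' Φ.H ⟨A, ⟨e₁.symm⟩⟩ hΦ' x
  obtain ⟨F, ⟨α⟩, hF⟩ := exists_isSequenceOfMorphisms Φ.H hess hΦ'
  refine ⟨_, _, _, _, inferInstance, F, ⟨ι.preimageIso (α.app ⊥ ≪≫ e₁)⟩, hF,
    cof_le_cof_sigmaLex, fun x X Y i a hi ↦ ?_⟩
  obtain ⟨j, k, rfl⟩ := exists_eq_lexMk x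
  have hGess : ι.essImage (G.obj (Order.succ j)) :=
    Functor.essImage.ofIso (Φ.isoG (Order.succ j)).symm (hess _)
  have h₁ := (lexMk_lt_lexMk_of_lt (Q := fun j ↦ (step (G.obj j)).Q) (Order.lt_succ j) k
    (⊥ : (step (G.obj (Order.succ j))).Q)).le
  have h₂ := (lexMk_lt_lexMk_of_lt (Q := fun j ↦ (step (G.obj j)).Q)
    (Order.lt_succ (Order.succ j))
    (⊥ : (step (G.obj (Order.succ j))).Q) (⊥ : (step (G.obj (Order.succ (Order.succ j)))).Q)).le
  obtain ⟨b, hb⟩ := (step (G.obj (Order.succ j))).exists_extension hGess i hi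
    (ι.map a ≫ α.hom.app _ ≫ Φ.H.map (homOfLE h₁) ≫ (Φ.isoG (Order.succ j)).inv)
  refine ⟨_, h₁.trans h₂, ι.preimage (b ≫ (e _).hom ≫ (Φ.isoG _).hom ≫ α.inv.app _),
    ι.map_injective ?_⟩
  have hα : ι.map (F.map (homOfLE (h₁.trans h₂))) =
      α.hom.app _ ≫ Φ.H.map (homOfLE (h₁.trans h₂)) ≫ α.inv.app _ := by
    rw [← α.hom.naturality_assoc]
    simp
  have hΦG : Φ.H.map (homOfLE h₂) = (Φ.isoG (Order.succ j)).inv ≫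
      G.map (homOfLE (Order.le_succ _)) ≫ (Φ.isoG (Order.succ (Order.succ j))).hom := by
    rw [← Φ.isoG_map (Order.le_succ _), Iso.inv_hom_id_assoc]
  have hcomp : Φ.H.map (homOfLE (h₁.trans h₂)) = Φ.H.map (homOfLE h₁) ≫ Φ.H.map (homOfLE h₂) :=
    Φ.H.map_comp (homOfLE h₁) (homOfLE h₂)
  rw [ι.map_comp, ι.map_preimage, ι.map_comp, hα, hcomp, hΦG, he, ← Category.assoc, hb]
  simp only [Category.assoc]

/-- The small object argument in a category that need not be cocomplete, for morphisms to a
terminal object. -/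
theorem exists_relativeCellComplexes_extension {I : MorphismProperty C}
    (hI : MorphismProperty.IsSmall.{v} I)
    (hne : ∀ Z : C, ∃ (A B : C) (i : A ⟶ B) (_ : A ⟶ Z), I i)
    (hpush : ∀ {A B X : C} (i : A ⟶ B) (a : A ⟶ X), I i → HasPushout i a)
    (hsoa : AdmitsSmallObjectArgument I) (A : C) :
    ∃ (T : C) (f : A ⟶ T), relativeCellComplexes I f ∧
      ∀ {X Y : C} (i : X ⟶ Y), I i → ∀ a : X ⟶ T, ∃ b : Y ⟶ T, i ≫ b = a := by
  obtain ⟨κ, hκ⟩ : ∃ κ : Cardinal.{v}, ∀ {X Y : C} (i : X ⟶ Y), I i →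
      IsSmallRelativeWith κ (relativeCellComplexes I) X := by
    obtain ⟨S, P, Q, i, rfl⟩ := (MorphismProperty.isSmall_iff_eq_ofHoms I).1 hI
    choose κ hκ using fun s ↦ hsoa.isSmallRelative (i s) ⟨s⟩
    refine ⟨Cardinal.sum κ, ?_⟩
    rintro _ _ _ ⟨s⟩ J _ _ _ _ F hJ hF
    exact hκ s J F ((Cardinal.le_sum κ s).trans_lt hJ) hF
  let c : Cardinal.{v} := Order.succ (max κ Cardinal.aleph0)
  have hc : c.IsRegular := Cardinal.isRegular_succ (le_max_right _ _)
  have := Cardinal.noMaxOrder hc.aleph0_le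
  have : Nonempty c.ord.ToType := Ordinal.nonempty_toType_iff.2 hc.ord_pos.ne'
  let : OrderBot c.ord.ToType := WellFoundedLT.toOrderBot _
  let : SuccOrder c.ord.ToType := SuccOrder.ofLinearWellFoundedLT _
  have hcof : κ < Order.cof c.ord.ToType := by
    rw [Ordinal.cof_toType, hc.cof_ord]
    exact (le_max_left _ _).trans_lt (Order.lt_succ _)
  let ι : C ⥤ (C ⥤ Type v)ᵒᵖ := coyoneda.rightOp
  have hι : PreservesColimitsOfSize.{v, v} ι := ⟨preservesColimitsOfShape_rightOp _ _⟩
  have hι' : PreservesColimitsOfShape WalkingSpan ι := preservesColimitsOfShape_rightOp _ _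
  have step (X : (C ⥤ Type v)ᵒᵖ) : Nonempty (CellStep ι I X) := by
    by_cases hX : ι.essImage X
    · exact nonempty_cellStep_of_essImage hI hne hX
    · exact nonempty_cellStep_of_not_essImage hX
  obtain ⟨K, _, _, _, _, F, ⟨e⟩, hF, hK, hext⟩ := exists_sequence_of_cellStep ι
    (fun X ↦ (step X).some) hpush hsoa.hasTransfiniteCompositions c.ord.ToType A
  have := hsoa.hasTransfiniteCompositions K F hF
  refine ⟨colimit F, e.inv ≫ colimit.ι F ⊥,
    MorphismProperty.transfiniteCompositionsOfShape_le_transfiniteCompositions _ K _ ⟨?_⟩,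
    fun {X Y} i hi a ↦ ?_⟩
  · exact
      { F := F
        isoBot := e
        isWellOrderContinuous := hF.isWellOrderContinuous
        incl := (colimit.cocone F).ι
        isColimit := colimit.isColimit F
        map_mem := hF.map_mem }
  · have : PreservesColimit F (coyoneda.obj (Opposite.op X)) :=
      hκ i hi K F (hcof.trans_le hK) ⟨hF.isWellOrderContinuous, fun j hj ↦
        MorphismProperty.le_transfiniteCompositions _ _ (hF.map_mem j hj)⟩
    obtain ⟨k, a', rfl⟩ : ∃ (k : K) (a' : X ⟶ F.obj k), a' ≫ colimit.ι F k = a :=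
      Types.jointly_surjective_of_isColimit
        (isColimitOfPreserves (coyoneda.obj (Opposite.op X)) (colimit.isColimit F)) a
    obtain ⟨l, h, b, hb⟩ := hext k i a' hi
    exact ⟨b ≫ colimit.ι F l, by rw [← Category.assoc, hb, Category.assoc, colimit.w]⟩

end SmallObjectArgument

namespace ExactStructure

attribute [local instance] hasBinaryBiproducts_of_finite_biproducts

lemma rlp_zero_iff {C : Type u} [Category.{v} C] [Preadditive C] [HasZeroObject C]
    {I : MorphismProperty C} {A : C} :
    I.rlp (0 : A ⟶ (0 : C)) ↔
      ∀ {X Y : C} (i : X ⟶ Y), I i → ∀ a : X ⟶ A, ∃ b : Y ⟶ A, i ≫ b = a := by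
  constructor
  · intro h X Y i hi a
    have := h i hi
    have sq : CommSq a i (0 : A ⟶ (0 : C)) 0 := ⟨by simp⟩
    exact ⟨sq.lift, sq.fac_left⟩
  · intro h X Y i hi
    refine ⟨fun {a b} _ ↦ ?_⟩
    obtain ⟨l, hl⟩ := h i hi a
    exact ⟨⟨l, hl, (isZero_zero C).eq_of_tgt _ _⟩⟩

variable {C : Type u} [Category.{v} C] [Preadditive C] [HasZeroObject C] [HasFiniteBiproducts C]
  {E : ExactStructure C} {I : MorphismProperty C}

/-- Every object embeds into an object of `(Cok I)^⊥` with quotient a cell complex. -/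
theorem exists_isConflation_rightPerp_cellComplexes (hI_small : MorphismProperty.IsSmall.{v} I)
    (hI : I ≤ E.inflations) (hI_hom : E.IsHomological I) (hI_soa : AdmitsSmallObjectArgument I)
    (hI_cell : relativeCellComplexes I ≤ E.inflations) (A : C) :
    ∃ (T B : C) (f : A ⟶ T) (g : T ⟶ B), E.IsConflation f g ∧
      E.rightPerp (cokernelsOf I) T ∧ cellComplexes I B := by
  obtain ⟨T, f, hf, hT⟩ : ∃ (T : C) (f : A ⟶ T), relativeCellComplexes I f ∧
      ∀ {X Y : C} (i : X ⟶ Y), I i → ∀ a : X ⟶ T, ∃ b : Y ⟶ T, i ≫ b = a := by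
    by_cases hne : ∃ (X Y : C) (i : X ⟶ Y), I i
    · obtain ⟨X, Y, i, hi⟩ := hne
      exact exists_relativeCellComplexes_extension hI_small (fun Z ↦ ⟨X, Y, i, 0, hi⟩)
        (fun i a hi ↦ by
          obtain ⟨_, _, _, sq⟩ := exists_isPushout (hI _ hi) a
          exact sq.hasPushout) hI_soa A
    · refine ⟨A, 𝟙 A, ?_, fun {X Y} i hi ↦ (hne ⟨X, Y, i, hi⟩).elim⟩
      exact MorphismProperty.transfiniteCompositionsOfShape_le_transfiniteCompositions _ _ _
        ((MorphismProperty.TransfiniteCompositionOfShape.id I.pushouts A).ofOrderIso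
          (orderIsoShrink.{v} (Fin 1)).symm).mem
  obtain ⟨B, g, hg⟩ := exists_isConflation_of_inflation (hI_cell _ hf)
  exact ⟨T, B, f, g, hg, hI_hom T (rlp_zero_iff.2 hT), cellComplexes_of_isConflation hI_cell hg hf⟩

lemma isLeftApproximation_of_isConflation {P : ObjectProperty C} {A T B : C} {f : A ⟶ T}
    {g : T ⟶ B} (h : E.IsConflation f g) (hT : P T) (hB : E.leftPerp P B) :
    IsLeftApproximation P f := by
  refine ⟨hT, fun Y hY a ↦ ?_⟩
  have := hasLiftingProperty_of_ext1Vanishes (hB Y hY) h (isConflation_id_zero E Y)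
  have sq : CommSq a f (0 : Y ⟶ (0 : C)) 0 := ⟨by simp⟩
  exact ⟨sq.lift, sq.fac_left⟩

/-- If `G ↠ A` is a deflation with `G` in `^⊥P`, then `A` has a special `^⊥P`-precover. -/
lemma exists_isConflation_leftPerp {P : ObjectProperty C}
    (h : ∀ K : C, ∃ (T B : C) (f : K ⟶ T) (g : T ⟶ B), E.IsConflation f g ∧ P T ∧ E.leftPerp P B)
    (hgen : E.IsClassOfGenerators (E.leftPerp P)) (A : C) :
    ∃ (T M : C) (f : T ⟶ M) (g : M ⟶ A), E.IsConflation f g ∧ P T ∧ E.leftPerp P M := by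
  obtain ⟨S, G, c, p, hG, hc, hp⟩ := hgen A
  obtain ⟨T, M, B, f, g, i, q, hfg, hiq, hT, hB⟩ :=
    exists_isConflation_of_deflation_of_approximation hp h
  exact ⟨T, M, f, g, hfg, hT, leftPerp_of_isConflation hiq
    (isClosedUnderCoproducts_leftPerp P S G hG c hc) hB⟩

lemma isDirectSummandOf_of_isConflation {P : ObjectProperty C} {T M A : C} {f : T ⟶ M}
    {g : M ⟶ A} (h : E.IsConflation f g) (hTA : E.Ext1Vanishes A T) (hM : P M) :
    IsDirectSummandOf P A := by
  obtain ⟨s, hs⟩ := hTA.exists_section h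
  obtain ⟨e, -, he, he'⟩ := h.exists_iso_of_section s hs
  let b : BinaryBicone A T :=
    { pt := M
      fst := g
      snd := e.inv ≫ biprod.fst
      inl := s
      inr := biprod.inl ≫ e.hom
      inl_fst := hs
      inl_snd := by simp [← he]
      inr_fst := by simp [he']
      inr_snd := by simp }
  refine ⟨T, b, ⟨isBinaryBilimitOfTotal b ?_⟩, hM⟩
  have : g = e.inv ≫ biprod.snd := by simp [← he']
  dsimp [b]
  rw [← cancel_epi e.hom, ← cancel_mono e.inv, this, ← he]
  apply biprod.hom_ext' <;> apply biprod.hom_ext <;> simp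

lemma isClassOfGenerators_mono {P Q : ObjectProperty C} (h : P ≤ Q)
    (hP : E.IsClassOfGenerators P) : E.IsClassOfGenerators Q := by
  intro A
  obtain ⟨S, G, c, p, hG, hc, hp⟩ := hP A
  exact ⟨S, G, c, p, fun s ↦ h _ (hG s), hc, hp⟩

end ExactStructure

theorem theorem3p6 {C : Type u} [Category.{v} C] [Preadditive C] [HasZeroObject C]
    [HasFiniteBiproducts C] (E : ExactStructure C) (I : MorphismProperty C)
    (hI_small : MorphismProperty.IsSmall.{v} I) (hI : I ≤ E.inflations)
    (hI_hom : E.IsHomological I) (hI_soa : AdmitsSmallObjectArgument I)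
    (hI_cell : relativeCellComplexes I ≤ E.inflations) :
    -- (a)
    ((∀ A : C, ∃ (T B : C) (f : A ⟶ T) (g : T ⟶ B) (w : f ≫ g = 0),
        E.conflation (ShortComplex.mk f g w) ∧
          E.rightPerp (cokernelsOf I) T ∧ cellComplexes I B) ∧
      IsCovariantlyFinite (E.rightPerp (cokernelsOf I))) ∧
    -- (b)
    (E.IsClassOfGenerators (cellComplexes I) →
      E.IsCompleteCotorsionPair (E.leftPerp (E.rightPerp (cokernelsOf I)))
        (E.rightPerp (cokernelsOf I))) ∧
    -- (c)
    (IsClosedUnderCoproducts (E.leftPerp (E.rightPerp (cokernelsOf I))) →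
      E.IsClassOfGenerators (E.leftPerp (E.rightPerp (cokernelsOf I))) →
      (∀ A : C, ∃ (T' B' : C) (f : T' ⟶ B') (g : B' ⟶ A) (w : f ≫ g = 0),
        E.conflation (ShortComplex.mk f g w) ∧ E.rightPerp (cokernelsOf I) T' ∧
          E.leftPerp (E.rightPerp (cokernelsOf I)) B') ∧
      E.IsCompleteCotorsionPair (E.leftPerp (E.rightPerp (cokernelsOf I)))
        (E.rightPerp (cokernelsOf I))) ∧
    -- (d)
    (IsClosedUnderCoproducts (E.filtered (cokernelsOf I)) →
      E.IsClosedUnderExtensions (E.filtered (cokernelsOf I)) →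
      E.IsClassOfGenerators (E.filtered (cokernelsOf I)) →
      ∀ A : C, E.leftPerp (E.rightPerp (cokernelsOf I)) A ↔
        IsDirectSummandOf (E.filtered (cokernelsOf I)) A) := by
  have ha :=
    ExactStructure.exists_isConflation_rightPerp_cellComplexes hI_small hI hI_hom hI_soa hI_cell
  have hfilt := ExactStructure.filtered_le_leftPerp_rightPerp (E := E) (cokernelsOf I)
  have hcell := (ExactStructure.cellComplexes_le_filtered hI).trans hfilt
  have ha' (K : C) : ∃ (T B : C) (f : K ⟶ T) (g : T ⟶ B), E.IsConflation f g ∧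
      E.rightPerp (cokernelsOf I) T ∧ E.leftPerp (E.rightPerp (cokernelsOf I)) B := by
    obtain ⟨T, B, f, g, h, hT, hB⟩ := ha K
    exact ⟨T, B, f, g, h, hT, hcell _ hB⟩
  have hcomplete (hgen : E.IsClassOfGenerators (E.leftPerp (E.rightPerp (cokernelsOf I)))) :
      E.IsCompleteCotorsionPair (E.leftPerp (E.rightPerp (cokernelsOf I)))
        (E.rightPerp (cokernelsOf I)) :=
    { ExactStructure.isCotorsionPair_leftPerp_rightPerp _ with
      enough_projectives := fun A ↦ by
        obtain ⟨T, M, f, g, ⟨w, h⟩, hT, hM⟩ :=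
          ExactStructure.exists_isConflation_leftPerp ha' hgen A
        exact ⟨T, M, f, g, w, h, hM, hT⟩
      enough_injectives := fun A ↦ by
        obtain ⟨T, B, f, g, ⟨w, h⟩, hT, hB⟩ := ha' A
        exact ⟨T, B, f, g, w, h, hB, hT⟩ }
  refine ⟨⟨fun A ↦ ?_, fun A ↦ ?_⟩,
    fun hgen ↦ hcomplete (ExactStructure.isClassOfGenerators_mono hcell hgen),
    fun _ hgen ↦ ⟨fun A ↦ ?_, hcomplete hgen⟩, fun hcoprod hext hgen A ↦ ⟨fun hA ↦ ?_, ?_⟩⟩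
  · obtain ⟨T, B, f, g, ⟨w, h⟩, hT, hB⟩ := ha A
    exact ⟨T, B, f, g, w, h, hT, hB⟩
  · obtain ⟨T, B, f, g, h, hT, hB⟩ := ha' A
    exact ⟨T, f, ExactStructure.isLeftApproximation_of_isConflation h hT hB⟩
  · obtain ⟨T, M, f, g, ⟨w, h⟩, hT, hM⟩ := ExactStructure.exists_isConflation_leftPerp ha' hgen A
    exact ⟨T, M, f, g, w, h, hT, hM⟩
  · obtain ⟨S, G, c, p, hG, hc, hp⟩ := hgen A
    obtain ⟨T, M, B, f, g, i, q, hfg, ⟨w, hiq⟩, hT, hB⟩ :=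
      ExactStructure.exists_isConflation_of_deflation_of_approximation hp ha
    exact ExactStructure.isDirectSummandOf_of_isConflation hfg (hA T hT)
      (hext _ hiq (hcoprod S G hG c hc) (ExactStructure.cellComplexes_le_filtered hI _ hB))
  · rintro ⟨A', b, -, hb⟩
    exact ExactStructure.leftPerp_of_retract b.inl b.fst b.inl_fst (hfilt _ hb)
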